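/- All manifolds, maps, functions and forms are smooth ($C^\infty$). A contact form on a $(2n+1)$-manifold $M$ is a 1-form $\omega$ such that $\omega\wedge(d\omega)^n$ vanishes nowhere. Forms $\omega_1,\dots,\omega_{p+1}$ on $M$ ($p\ge 0$) generate a contact $p$-sphere $\mathcal S^p_c\{\omega_1,\dots,\omega_{p+1}\}=\{\sum_i\lambda_i\omega_i : \sum_i\lambda_i^2=1\}$ if every element of this family is a contact form. On a principal $\mathbb S^1$-bundle it is called invariant if all its elements are invariant under the $\mathbb S^1$-action. Let $k\ge 1$, let $B$ be a manifold, $N\subset B$ a subset, and $f$ a map from $B\setminus N$ to the unit sphere $\mathbb S^{k-1}\subset\mathbb R^k$. One says that $(B,f,N)$ is a knotted fibration (along $N$) over $\mathbb S^{k-1}$ if 1. $B$ is connected, orientable and compact; 2. $N$ is empty or a closed submanifold of $B$ of codimension $k$; 3. $f:B\setminus N\to\mathbb S^{k-1}$ is a smooth locally trivial fibration, that is, every $q\in\mathbb S^{k-1}$ has an open neighbourhood $U$ in $\mathbb S^{k-1}$ with a diffeomorphism $f^{-1}(U)\cong U\times f^{-1}(q)$ over $U$ (for $k=1$ the two fibres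 need not be diffeomorphic, and one may be empty); 4. if $N$ is non-empty, there are an open neighbourhood $W$ of $N$ and a diffeomorphism $h:N\times D^k\to W$, where $D^k$ is the open unit disk of $\mathbb R^k$, such that $h(z,0)=z$ for all $z\in N$ and $f(h(z,x))=x/\|x\|$ for all $z\in N$ and $x\in D^k\setminus\{0\}$. **Theorem (Fibration theorem).** Let $n,p\ge 0$, let $\pi:M\to B$ be a $(2n+1)$-dimensional principal $\mathbb S^1$-bundle over a closed, connected, orientable $2n$-manifold $B$, with connection form $\alpha$ (an invariant real 1-form with value $1$ on the fundamental vector field of the action), and let $\mathcal S^p_c\{\omega_1,\dots,\omega_{p+1}\}$ be an invariant contact $p$-sphere on $M$. Write $$\omega_i=\pi^*(\eta_i)+\pi^*(\varphi_i)\,\alpha,\qquad i=1,\dots,p+1,$$ with 1-forms $\eta_i$ and functions $\varphi_i$ on $B$. Let $\Sigma=\bigcap_{i=1}^{p+1}\varphi_i^{-1}(0)$ and $r=\sqrt{\sum_{i=1}^{p+1}\varphi_i^2}$. Then $$\Big(B,\ \Big(\frac{\varphi_1}{r},\dots,\frac{\varphi_{p+1}}{r}\Big),\ \Sigma\Big)$$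 is a knotted fibration over $\mathbb S^p$. -/

import Mathlib

open scoped Manifold ContDiff

namespace ContactSphere

/-! ### Smooth maps on subsets, submanifolds, orientability -/

section Subsets

variable {E₁ H₁ X E₂ H₂ Y : Type*}
  [NormedAddCommGroup E₁] [NormedSpace ℝ E₁] [TopologicalSpace H₁]
  [TopologicalSpace X] [ChartedSpace H₁ X]
  [NormedAddCommGroup E₂] [NormedSpace ℝ E₂] [TopologicalSpace H₂]
  [TopologicalSpace Y] [ChartedSpace H₂ Y]

/-- A map is smooth on an arbitrary subset `s` of a manifold if near each point of `s` it agrees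
on `s` with a smooth map defined on an open set of the ambient manifold. For an embedded
submanifold `s` this is smoothness for the submanifold structure of `s`. -/
def SmoothOnSubset (I : ModelWithCorners ℝ E₁ H₁) (J : ModelWithCorners ℝ E₂ H₂)
    (f : X → Y) (s : Set X) : Prop :=
  ∀ x ∈ s, ∃ U : Set X, IsOpen U ∧ x ∈ U ∧
    ∃ F : X → Y, ContMDiffOn I J ∞ F U ∧ Set.EqOn F f (U ∩ s)

/-- `f` restricts to a diffeomorphism from the subset `s` of `X` onto the subset `t` of `Y`. -/
def IsDiffeoOn (I : ModelWithCorners ℝ E₁ H₁) (J : ModelWithCorners ℝ E₂ H₂)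
    (f : X → Y) (s : Set X) (t : Set Y) : Prop :=
  Set.MapsTo f s t ∧ SmoothOnSubset I J f s ∧
    ∃ g : Y → X, Set.MapsTo g t s ∧ SmoothOnSubset J I g t ∧ Set.InvOn g f s t

end Subsets

section Manifolds

/-- `N` is a closed (embedded) submanifold of codimension `k` of the `d`-manifold `B`: it is a
closed subset which, in suitable smooth charts of `B`, is a linear subspace of codimension `k`. -/
def IsClosedSubmanifold (d k : ℕ) {B : Type*} [TopologicalSpace B]
    [ChartedSpace (EuclideanSpace ℝ (Fin d)) B] (N : Set B) : Prop :=
  IsClosed N ∧ ∀ z ∈ N, ∃ e ∈ IsManifold.maximalAtlas (𝓡 d) ∞ B, z ∈ e.source ∧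
    ∃ V : Submodule ℝ (EuclideanSpace ℝ (Fin d)), Module.finrank ℝ V + k = d ∧
      ∀ x ∈ e.source, (x ∈ N ↔ e x ∈ V)

/-- The `d`-manifold `B` is orientable: it is covered by smooth charts all of whose transition maps
have positive Jacobian determinant. -/
def IsOrientable (d : ℕ) (B : Type*) [TopologicalSpace B]
    [ChartedSpace (EuclideanSpace ℝ (Fin d)) B] : Prop :=
  ∃ A ⊆ IsManifold.maximalAtlas (𝓡 d) ∞ B, (∀ x : B, ∃ e ∈ A, x ∈ e.source) ∧
    ∀ e ∈ A, ∀ e' ∈ A, ∀ x ∈ e.source ∩ e'.source,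
      0 < (fderiv ℝ (fun y => e' (e.symm y)) (e x)).det

/-- `f` restricts to a smooth locally trivial fibration from the open set `X` of the `d`-manifold
`B` to the unit sphere of `ℝᵏ`: each point `q` of the sphere has a neighbourhood over which `f` is
diffeomorphic, compatibly with the projections, to the product with the fibre over `q`. -/
def IsLocallyTrivialFibration (d : ℕ) {k : ℕ} {B : Type*} [TopologicalSpace B]
    [ChartedSpace (EuclideanSpace ℝ (Fin d)) B]
    (f : B → EuclideanSpace ℝ (Fin k)) (X : Set B) : Prop :=
  Set.MapsTo f X (Metric.sphere 0 1) ∧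
    ∀ q ∈ Metric.sphere (0 : EuclideanSpace ℝ (Fin k)) 1,
      ∃ U : Set (EuclideanSpace ℝ (Fin k)), IsOpen U ∧ q ∈ U ∧
        ∃ g : B → EuclideanSpace ℝ (Fin k) × B,
          IsDiffeoOn (𝓡 d) ((𝓡 k).prod (𝓡 d)) g (X ∩ f ⁻¹' U)
            ((Metric.sphere 0 1 ∩ U) ×ˢ (X ∩ f ⁻¹' {q})) ∧
          ∀ x ∈ X ∩ f ⁻¹' U, (g x).1 = f x

/-- `(B, f, N)` is a knotted fibration along `N` over the unit sphere `S^{k-1}` of `ℝᵏ`. The map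
`f` is only relevant on the complement of `N`. -/
structure IsKnottedFibration (d : ℕ) {k : ℕ} (B : Type*) [TopologicalSpace B]
    [ChartedSpace (EuclideanSpace ℝ (Fin d)) B]
    (f : B → EuclideanSpace ℝ (Fin k)) (N : Set B) : Prop where
  connected : ConnectedSpace B
  orientable : IsOrientable d B
  compact : CompactSpace B
  knot : N = ∅ ∨ IsClosedSubmanifold d k N
  fibration : IsLocallyTrivialFibration d f Nᶜ
  tube : N.Nonempty → ∃ W : Set B, IsOpen W ∧ N ⊆ W ∧
    ∃ h : B × EuclideanSpace ℝ (Fin k) → B,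
      IsDiffeoOn ((𝓡 d).prod (𝓡 k)) (𝓡 d) h (N ×ˢ Metric.ball 0 1) W ∧
      (∀ z ∈ N, h (z, 0) = z) ∧
      ∀ z ∈ N, ∀ x ∈ Metric.ball (0 : EuclideanSpace ℝ (Fin k)) 1, x ≠ 0 →
        f (h (z, x)) = ‖x‖⁻¹ • x

end Manifolds

/-! ### Differential 1-forms and contact forms -/

noncomputable section Forms

/-- A (not necessarily smooth) real 1-form on a `d`-manifold. -/
abbrev OneForm (d : ℕ) (M : Type*) [TopologicalSpace M]
    [ChartedSpace (EuclideanSpace ℝ (Fin d)) M] : Type _ :=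
  ∀ m : M, TangentSpace (𝓡 d) m →L[ℝ] ℝ

variable {d e : ℕ} {M : Type*} [TopologicalSpace M] [ChartedSpace (EuclideanSpace ℝ (Fin d)) M]
  {B : Type*} [TopologicalSpace B] [ChartedSpace (EuclideanSpace ℝ (Fin e)) B]

/-- Smoothness of a 1-form, as a section of the cotangent bundle. -/
def OneForm.IsSmooth [IsManifold (𝓡 d) ∞ M] (θ : OneForm d M) : Prop :=
  ContMDiff (𝓡 d) ((𝓡 d).prod 𝓘(ℝ, EuclideanSpace ℝ (Fin d) →L[ℝ] ℝ)) ∞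
    (fun m => (⟨m, θ m⟩ : Bundle.TotalSpace (EuclideanSpace ℝ (Fin d) →L[ℝ] ℝ)
      (fun m : M => TangentSpace (𝓡 d) m →L[ℝ] Bundle.Trivial M ℝ m)))

/-- The pullback `f^* θ`. -/
def OneForm.pullback (f : M → B) (θ : OneForm e B) : OneForm d M :=
  fun m => (θ (f m)).comp (mfderiv (𝓡 d) (𝓡 e) f m)

/-- The local expression of `θ` in the preferred chart at `m`, a 1-form on (an open subset of)
`ℝᵈ`. -/
def OneForm.inChart (θ : OneForm d M) (m : M) :
    EuclideanSpace ℝ (Fin d) → EuclideanSpace ℝ (Fin d) [⋀^Fin 1]→L[ℝ] ℝ :=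
  fun y => ContinuousAlternatingMap.ofSubsingleton ℝ (EuclideanSpace ℝ (Fin d)) ℝ (0 : Fin 1)
    ((θ ((chartAt (EuclideanSpace ℝ (Fin d)) m).symm y)).comp
      (mfderiv 𝓘(ℝ, EuclideanSpace ℝ (Fin d)) (𝓡 d)
        (chartAt (EuclideanSpace ℝ (Fin d)) m).symm y))

/-- The exterior derivative of a 1-form at the point `m`, computed in the preferred chart at `m`. -/
def OneForm.extDeriv (θ : OneForm d M) (m : M) : TangentSpace (𝓡 d) m [⋀^Fin 2]→L[ℝ] ℝ :=
  (_root_.extDeriv (θ.inChart m) (chartAt (EuclideanSpace ℝ (Fin d)) m m)).compContinuousLinearMap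
    (mfderiv (𝓡 d) 𝓘(ℝ, EuclideanSpace ℝ (Fin d)) (chartAt (EuclideanSpace ℝ (Fin d)) m) m)

/-- The `(2n+1)`-form `a ∧ bⁿ` on a vector space, for a linear form `a` and a 2-form `b`, evaluated
on `2n+1` vectors. -/
def wedgePow {V : Type*} [TopologicalSpace V] [AddCommGroup V] [Module ℝ V] (n : ℕ)
    (a : V →L[ℝ] ℝ) (b : V [⋀^Fin 2]→L[ℝ] ℝ) (v : Fin (2 * n + 1) → V) : ℝ :=
  (1 / 2 ^ n : ℝ) * ∑ σ : Equiv.Perm (Fin (2 * n + 1)), ((Equiv.Perm.sign σ : ℤ) : ℝ) *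
    (a (v (σ 0)) * ∏ i : Fin n,
      b ![v (σ ⟨2 * i + 1, by omega⟩), v (σ ⟨2 * i + 2, by omega⟩)])

/-- A contact form on a `(2n+1)`-manifold: a smooth 1-form `θ` such that `θ ∧ (dθ)ⁿ` vanishes at
no point. -/
def IsContactForm (n : ℕ) {M : Type*} [TopologicalSpace M]
    [ChartedSpace (EuclideanSpace ℝ (Fin (2 * n + 1))) M] [IsManifold (𝓡 (2 * n + 1)) ∞ M]
    (θ : OneForm (2 * n + 1) M) : Prop :=
  θ.IsSmooth ∧ ∀ m : M, ∃ v : Fin (2 * n + 1) → TangentSpace (𝓡 (2 * n + 1)) m,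
    wedgePow n (θ m) (θ.extDeriv m) v ≠ 0

/-- The family of normalized linear combinations of the 1-forms `Ω i`. -/
def normalizedCombinations {p : ℕ} (Ω : Fin (p + 1) → OneForm d M) : Set (OneForm d M) :=
  {θ | ∃ l : Fin (p + 1) → ℝ, ∑ i, l i ^ 2 = 1 ∧ θ = ∑ i, l i • Ω i}

/-- The 1-forms `Ω i` generate a contact `p`-sphere. -/
def IsContactSphere (n : ℕ) {p : ℕ} {M : Type*} [TopologicalSpace M]
    [ChartedSpace (EuclideanSpace ℝ (Fin (2 * n + 1))) M] [IsManifold (𝓡 (2 * n + 1)) ∞ M]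
    (Ω : Fin (p + 1) → OneForm (2 * n + 1) M) : Prop :=
  ∀ θ ∈ normalizedCombinations Ω, IsContactForm n θ

/-! ### Principal circle bundles -/

/-- `π : M → B` is a smooth principal circle bundle, for the given action of the circle on `M`. -/
structure IsPrincipalCircleBundle [MulAction Circle M] (π : M → B) : Prop where
  smooth_action : ContMDiff ((𝓡 1).prod (𝓡 d)) (𝓡 d) ∞ (fun x : Circle × M => x.1 • x.2)
  smooth_proj : ContMDiff (𝓡 d) (𝓡 e) ∞ π
  proj_smul : ∀ (z : Circle) (m : M), π (z • m) = π m
  locally_trivial : ∀ b : B, ∃ U : Set B, IsOpen U ∧ b ∈ U ∧ ∃ t : M → Circle,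
    (∀ m ∈ π ⁻¹' U, ∀ z : Circle, t (z • m) = z * t m) ∧
    IsDiffeoOn (𝓡 d) ((𝓡 e).prod (𝓡 1)) (fun m => (π m, t m)) (π ⁻¹' U) (U ×ˢ Set.univ)

/-- A 1-form on `M` is invariant under the circle action. -/
def OneForm.IsInvariant [MulAction Circle M] (θ : OneForm d M) : Prop :=
  ∀ z : Circle, OneForm.pullback (fun m : M => z • m) θ = θ

/-- `α` is a connection form: a smooth invariant 1-form taking the value `1` on the fundamental
vector field `m ↦ d/dt|_{t=0} (exp(it) • m)` of the circle action. -/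
structure IsConnectionForm [IsManifold (𝓡 d) ∞ M] [MulAction Circle M]
    (α : OneForm d M) : Prop where
  smooth : α.IsSmooth
  invariant : α.IsInvariant
  fundamental : ∀ m : M,
    α (Circle.exp 0 • m) (mfderiv 𝓘(ℝ, ℝ) (𝓡 d) (fun t : ℝ => Circle.exp t • m) 0 (1 : ℝ)) = 1

end Forms

end ContactSphere

namespace ContactSphere

/-! ### Linear algebra: the form `a ∧ bⁿ` and common kernel vectors of `a` and `b`. -/

section Wedge

variable {V : Type*} [TopologicalSpace V] [AddCommGroup V] [Module ℝ V]

/-! Put `Φ = (φ₁, …, φ_{p+1})`. The contact condition is used once, in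
`IsContactSphere.mfderiv_ne_zero`. For a unit vector `l`, let `θ = ∑ lᵢ ωᵢ = π^*ζ + (G ∘ π) α` with
`G = ⟨l, Φ⟩`. If `G` and `dG` both vanished at `b`, then at a point over `b` one would have `θ =
π^*ζ` and `dθ = π^*dζ`, so a nonzero vertical vector would lie in the kernel of both, and `θ ∧
(dθ)ⁿ` would vanish there (`wedgePow_eq_zero_of_kernel`). Hence no `l ≠ 0` is orthogonal both to `Φ
b` and to the image of `dΦ` at `b`: `Φ` is radially transverse.

The rest is differential topology of radially transverse maps on a compact manifold. At zeros `Φ` is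
a submersion, which gives the submanifold; elsewhere `Φ/‖Φ‖` is one. Instead of flows of vector
fields, the trivializations come from families of maps `T(w, ·)` with `T(0, ·) = id` that change the
value of `Φ` in a way prescribed by `w`. The implicit function theorem gives them locally
(`exists_local_move`). As the prescribed changes are additive in `w`, a partition of unity glues
them (`exists_global_move`), and compactness makes `T(w, ·)` invertible for small `w`
(`exists_global_inverse`).

Shearing the values up to a positive factor moves the fibre over `q` to nearby fibres and preserves
the zero set, so the noncompactness of the complement does no harm
(`isLocallyTrivialFibration_radial`). Translating the values near the zero set gives the tube
(`exists_tube_radial`). -/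

theorem exists_linearMap_update_mul_prod (n : ℕ) (a : V →L[ℝ] ℝ) (b : V [⋀^Fin 2]→L[ℝ] ℝ)
    (v : Fin (2 * n + 1) → V) (j : Fin (2 * n + 1)) :
    ∃ l : V →ₗ[ℝ] ℝ, ∀ x, (a (Function.update v j x 0) * ∏ i : Fin n,
      b ![Function.update v j x ⟨2 * i + 1, by omega⟩,
        Function.update v j x ⟨2 * i + 2, by omega⟩]) = l x := by
  obtain ⟨j, hj⟩ := j
  rcases Nat.eq_zero_or_pos j with rfl | hpos
  · refine ⟨(∏ i : Fin n, b ![v ⟨2 * i + 1, by omega⟩, v ⟨2 * i + 2, by omega⟩]) •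
      (a : V →ₗ[ℝ] ℝ), fun x => ?_⟩
    have h0 : (⟨0, hj⟩ : Fin (2 * n + 1)) = 0 := rfl
    have h1 : ∀ i : Fin n, (⟨2 * i + 1, by omega⟩ : Fin (2 * n + 1)) ≠ 0 := fun i h => by
      simp [Fin.ext_iff] at h
    have h2 : ∀ i : Fin n, (⟨2 * i + 2, by omega⟩ : Fin (2 * n + 1)) ≠ 0 := fun i h => by
      simp [Fin.ext_iff] at h
    simp only [h0, Function.update_self, Function.update_of_ne (h1 _),
      Function.update_of_ne (h2 _), LinearMap.smul_apply, smul_eq_mul]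
    exact mul_comm _ _
  -- A slot `j ≥ 1` belongs to exactly one pair `(2i + 1, 2i + 2)`, that with `i = (j - 1) / 2`;
  -- only this factor sees the update.
  · have hi : (j - 1) / 2 < n := by omega
    set i₀ : Fin n := ⟨(j - 1) / 2, hi⟩ with hi₀
    have key : ∀ x, (a (Function.update v ⟨j, hj⟩ x 0) * ∏ i : Fin n,
        b ![Function.update v ⟨j, hj⟩ x ⟨2 * i + 1, by omega⟩,
          Function.update v ⟨j, hj⟩ x ⟨2 * i + 2, by omega⟩]) =
        (a (v 0) * ∏ i ∈ Finset.univ.erase i₀,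
          b ![v ⟨2 * i + 1, by omega⟩, v ⟨2 * i + 2, by omega⟩]) *
        b ![Function.update v ⟨j, hj⟩ x ⟨2 * i₀ + 1, by omega⟩,
          Function.update v ⟨j, hj⟩ x ⟨2 * i₀ + 2, by omega⟩] := by
      intro x
      rw [← Finset.mul_prod_erase _ _ (Finset.mem_univ i₀)]
      have h0 : (0 : Fin (2 * n + 1)) ≠ ⟨j, hj⟩ := fun h => by
        simp [Fin.ext_iff] at h; omega
      rw [Function.update_of_ne h0]
      have hprod : ∏ i ∈ Finset.univ.erase i₀,
          b ![Function.update v ⟨j, hj⟩ x ⟨2 * i + 1, by omega⟩,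
            Function.update v ⟨j, hj⟩ x ⟨2 * i + 2, by omega⟩] =
          ∏ i ∈ Finset.univ.erase i₀,
            b ![v ⟨2 * i + 1, by omega⟩, v ⟨2 * i + 2, by omega⟩] := by
        refine Finset.prod_congr rfl fun i hi => ?_
        have hne : (i : ℕ) ≠ (j - 1) / 2 := fun h =>
          (Finset.ne_of_mem_erase hi) (Fin.ext h)
        rw [Function.update_of_ne, Function.update_of_ne]
        · intro h; simp [Fin.ext_iff] at h; omega
        · intro h; simp [Fin.ext_iff] at h; omega
      rw [hprod]
      ring
    rcases Nat.even_or_odd' j with ⟨c, hc | hc⟩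
    · refine ⟨(a (v 0) * ∏ i ∈ Finset.univ.erase i₀,
          b ![v ⟨2 * i + 1, by omega⟩, v ⟨2 * i + 2, by omega⟩]) •
        b.toMultilinearMap.toLinearMap ![v ⟨2 * i₀ + 1, by omega⟩, 0] 1, fun x => ?_⟩
      have e2 : (⟨2 * i₀ + 2, by omega⟩ : Fin (2 * n + 1)) = ⟨j, hj⟩ := by
        apply Fin.ext; simp [hi₀]; omega
      have e1 : (⟨2 * i₀ + 1, by omega⟩ : Fin (2 * n + 1)) ≠ ⟨j, hj⟩ := by
        intro h; simp [Fin.ext_iff, hi₀] at h; omega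
      rw [key, e2, Function.update_self, Function.update_of_ne e1, LinearMap.smul_apply,
        smul_eq_mul]
      congr 1
      change b _ = b _
      congr 1
      ext k
      fin_cases k <;> simp
    · refine ⟨(a (v 0) * ∏ i ∈ Finset.univ.erase i₀,
          b ![v ⟨2 * i + 1, by omega⟩, v ⟨2 * i + 2, by omega⟩]) •
        b.toMultilinearMap.toLinearMap ![0, v ⟨2 * i₀ + 2, by omega⟩] 0, fun x => ?_⟩
      have e2 : (⟨2 * i₀ + 1, by omega⟩ : Fin (2 * n + 1)) = ⟨j, hj⟩ := by
        apply Fin.ext; simp [hi₀]; omega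
      have e1 : (⟨2 * i₀ + 2, by omega⟩ : Fin (2 * n + 1)) ≠ ⟨j, hj⟩ := by
        intro h; simp [Fin.ext_iff, hi₀] at h; omega
      rw [key, e2, Function.update_self, Function.update_of_ne e1, LinearMap.smul_apply,
        smul_eq_mul]
      congr 1
      change b _ = b _
      congr 1
      ext k
      fin_cases k <;> simp

/-- The multilinear map whose antisymmetrization is `a ∧ bⁿ`. -/
noncomputable def wedgeMultilinear (n : ℕ) (a : V →L[ℝ] ℝ) (b : V [⋀^Fin 2]→L[ℝ] ℝ) :
    MultilinearMap ℝ (fun _ : Fin (2 * n + 1) => V) ℝ :=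
  MultilinearMap.mk' (fun v => a (v 0) * ∏ i : Fin n,
      b ![v ⟨2 * i + 1, by omega⟩, v ⟨2 * i + 2, by omega⟩])
    (fun v j x y => by
      obtain ⟨l, hl⟩ := exists_linearMap_update_mul_prod n a b v j
      simp only [hl, map_add])
    (fun v j c x => by
      obtain ⟨l, hl⟩ := exists_linearMap_update_mul_prod n a b v j
      simp only [hl, map_smul])

theorem wedgePow_eq_alternatization (n : ℕ) (a : V →L[ℝ] ℝ) (b : V [⋀^Fin 2]→L[ℝ] ℝ)
    (v : Fin (2 * n + 1) → V) :
    wedgePow n a b v = (1 / 2 ^ n : ℝ) *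
      MultilinearMap.alternatization (wedgeMultilinear n a b) v := by
  rw [wedgePow, MultilinearMap.alternatization_apply]
  congr 1
  refine Finset.sum_congr rfl fun σ _ => ?_
  rw [Units.smul_def, zsmul_eq_mul]
  rfl

/-- An alternating map with as many arguments as the dimension is zero once it vanishes on one
basis. Take a basis containing `ξ`: every term of the antisymmetrization then has a factor `a ξ`,
`b(ξ, ·)` or `b(·, ξ)`. -/
theorem wedgePow_eq_zero_of_kernel (n : ℕ) (hV : Module.finrank ℝ V = 2 * n + 1)
    (a : V →L[ℝ] ℝ) (b : V [⋀^Fin 2]→L[ℝ] ℝ) {ξ : V} (hξ : ξ ≠ 0) (ha : a ξ = 0)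
    (hb : ∀ w, b ![ξ, w] = 0) (v : Fin (2 * n + 1) → V) : wedgePow n a b v = 0 := by
  have hb' : ∀ w, b ![w, ξ] = 0 := fun w => by
    have h := b.toAlternatingMap.map_swap ![ξ, w] (show (0 : Fin 2) ≠ 1 by decide)
    have e : (![ξ, w] ∘ Equiv.swap (0 : Fin 2) 1) = ![w, ξ] := by
      ext k; fin_cases k <;> simp
    rw [e, show b.toAlternatingMap ![ξ, w] = 0 from hb w, neg_zero] at h
    exact h
  rw [wedgePow_eq_alternatization]
  set A := MultilinearMap.alternatization (wedgeMultilinear n a b) with hA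
  have hzero : ∀ u : Fin (2 * n + 1) → V, ∀ j, u j = ξ → A u = 0 := by
    intro u j hj
    rw [hA, MultilinearMap.alternatization_apply]
    refine Finset.sum_eq_zero fun σ _ => ?_
    have : wedgeMultilinear n a b (fun i => u (σ i)) = 0 := by
      change a (u (σ 0)) * ∏ i : Fin n, b ![u (σ ⟨2 * i + 1, by omega⟩),
        u (σ ⟨2 * i + 2, by omega⟩)] = 0
      obtain ⟨⟨k, hk⟩, rfl⟩ := σ.surjective j
      rcases Nat.eq_zero_or_pos k with rfl | hpos
      · rw [show (0 : Fin (2 * n + 1)) = ⟨0, hk⟩ from rfl, hj, ha, zero_mul]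
      · refine mul_eq_zero_of_right _ (Finset.prod_eq_zero
          (Finset.mem_univ (⟨(k - 1) / 2, by omega⟩ : Fin n)) ?_)
        rcases Nat.even_or_odd' k with ⟨c, hc | hc⟩
        · have : (⟨2 * ((k - 1) / 2) + 2, by omega⟩ : Fin (2 * n + 1)) = ⟨k, hk⟩ :=
            Fin.ext (by simp; omega)
          simp only [this, hj, hb']
        · have : (⟨2 * ((k - 1) / 2) + 1, by omega⟩ : Fin (2 * n + 1)) = ⟨k, hk⟩ :=
            Fin.ext (by simp; omega)
          simp only [this, hj, hb]
    rw [show (wedgeMultilinear n a b).domDomCongr σ u =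
      wedgeMultilinear n a b (fun i => u (σ i)) from rfl, this, smul_zero]
  have : Module.Finite ℝ V := Module.finite_of_finrank_pos (by omega)
  obtain ⟨e⟩ : Nonempty {e : Module.Basis (Fin (2 * n + 1)) ℝ V // ∃ j, e j = ξ} := by
    have hli : LinearIndepOn ℝ id ({ξ} : Set V) := by simpa using hξ
    let B := Module.Basis.extend hli
    have hmem : ξ ∈ hli.extend (Set.subset_univ _) :=
      hli.subset_extend (Set.subset_univ _) (Set.mem_singleton ξ)
    have : Fintype (hli.extend (Set.subset_univ _)) :=
      FiniteDimensional.fintypeBasisIndex B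
    have hcard : Fintype.card (hli.extend (Set.subset_univ _)) = Fintype.card (Fin (2 * n + 1)) := by
      rw [← Module.finrank_eq_card_basis B, hV, Fintype.card_fin]
    let r := Fintype.equivOfCardEq hcard
    exact ⟨⟨B.reindex r, r ⟨ξ, hmem⟩, by simp [B]⟩⟩
  obtain ⟨e, j, hj⟩ := e
  have : A = 0 := (AlternatingMap.map_basis_eq_zero_iff e A).1 (hzero e j hj)
  rw [this]
  simp

end Wedge

/-! ### Exterior derivative of `π^*ζ + (G ∘ π) α` on vertical vectors. -/

section ExteriorDerivative

open Topology Filter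

variable {d e : ℕ} {M : Type*} [TopologicalSpace M] [ChartedSpace (EuclideanSpace ℝ (Fin d)) M]
  {B : Type*} [TopologicalSpace B] [ChartedSpace (EuclideanSpace ℝ (Fin e)) B]

theorem OneForm.IsSmooth.differentiableAt_inChart [IsManifold (𝓡 d) ∞ M] {θ : OneForm d M}
    (hθ : θ.IsSmooth) (m : M) :
    DifferentiableAt ℝ (θ.inChart m) (chartAt (EuclideanSpace ℝ (Fin d)) m m) := by
  have : IsManifold (𝓡 d) 1 M := IsManifold.of_le (n := ∞) (by exact_mod_cast le_top)
  set c := chartAt (EuclideanSpace ℝ (Fin d)) m with hc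
  have h1 := ((contMDiffAt_hom_bundle _).1 (hθ m)).2
  have h2 : ContMDiffAt 𝓘(ℝ, EuclideanSpace ℝ (Fin d))
      𝓘(ℝ, EuclideanSpace ℝ (Fin d) →L[ℝ] ℝ) ∞ (fun y =>
      ContinuousLinearMap.inCoordinates (EuclideanSpace ℝ (Fin d)) (TangentSpace (𝓡 d)) ℝ
        (Bundle.Trivial M ℝ) m (c.symm y) m (c.symm y) (θ (c.symm y))) (c m) := by
    have h3 : ContMDiffAt 𝓘(ℝ, EuclideanSpace ℝ (Fin d)) (𝓡 d) ∞ c.symm (c m) :=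
      contMDiffAt_symm_of_mem_maximalAtlas (IsManifold.chart_mem_maximalAtlas m)
        (c.map_source (mem_chart_source _ m))
    refine ContMDiffAt.comp (c m) (g := fun x => ContinuousLinearMap.inCoordinates
      (EuclideanSpace ℝ (Fin d)) (TangentSpace (𝓡 d)) ℝ
        (Bundle.Trivial M ℝ) m x m x (θ x)) ?_ h3
    rw [c.left_inv (mem_chart_source _ m)]
    exact h1
  have h4 := h2.contDiffAt.differentiableAt (by simp)
  -- The inverse of the tangent trivialization centred at `m` is the derivative of the inverse
  -- chart, so bundle coordinates and `inChart` agree near the centre.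
  have h5 : θ.inChart m =ᶠ[𝓝 (c m)] fun y =>
      ContinuousAlternatingMap.ofSubsingleton ℝ (EuclideanSpace ℝ (Fin d)) ℝ (0 : Fin 1)
      (ContinuousLinearMap.inCoordinates (EuclideanSpace ℝ (Fin d)) (TangentSpace (𝓡 d)) ℝ
        (Bundle.Trivial M ℝ) m (c.symm y) m (c.symm y) (θ (c.symm y))) := by
    filter_upwards [c.open_target.mem_nhds (c.map_source (mem_chart_source _ m))] with y hy
    have hs : c.symm y ∈ c.source := c.map_target hy
    have h6 := TangentBundle.symmL_trivializationAt (I := 𝓡 d) (x₀ := m) hs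
    have h7 : extChartAt (𝓡 d) m (c.symm y) = y := by
      simp [extChartAt, ← hc, c.right_inv hy]
    have h8 : ((extChartAt (𝓡 d) m).symm : EuclideanSpace ℝ (Fin d) → M) = c.symm := by
      ext; simp [extChartAt, ← hc]
    rw [h7, h8, ModelWithCorners.range_eq_univ, mfderivWithin_univ] at h6
    simp only [OneForm.inChart, ContinuousLinearMap.inCoordinates]
    congr 1
    ext v
    simp only [ContinuousLinearMap.comp_apply]
    rw [h6]
    simp
    rfl
  exact (((ContinuousAlternatingMap.ofSubsingletonLIE (𝕜 := ℝ) (E := EuclideanSpace ℝ (Fin d))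
    (F := ℝ) (0 : Fin 1)).toContinuousLinearEquiv.differentiableAt).comp _ h4).congr_of_eventuallyEq h5

/-- Formally `dθ = π^*dζ + dG ∧ α + G dα`, with `G` pulled back. Both `G` and `dG` vanish at the
point in question, which leaves `π^*dζ`, and this annihilates vertical vectors. -/
theorem OneForm.extDeriv_apply_eq_zero [IsManifold (𝓡 d) ∞ M] [IsManifold (𝓡 e) ∞ B]
    {π : M → B} (hπ : ContMDiff (𝓡 d) (𝓡 e) ∞ π) {θ α : OneForm d M} {ζ : OneForm e B}
    {G : B → ℝ} (m : M) (hζ : DifferentiableAt ℝ (ζ.inChart (π m))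
      (chartAt (EuclideanSpace ℝ (Fin e)) (π m) (π m)))
    (hα : DifferentiableAt ℝ (α.inChart m) (chartAt (EuclideanSpace ℝ (Fin d)) m m))
    (hG : MDifferentiableAt (𝓡 e) 𝓘(ℝ, ℝ) G (π m)) (hG0 : G (π m) = 0)
    (hdG : mfderiv (𝓡 e) 𝓘(ℝ, ℝ) G (π m) = 0)
    (hθ : ∀ m', θ m' = ζ.pullback π m' + G (π m') • α m')
    {ξ : TangentSpace (𝓡 d) m} (hξ : mfderiv (𝓡 d) (𝓡 e) π m ξ = 0) (w : TangentSpace (𝓡 d) m) :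
    θ.extDeriv m ![ξ, w] = 0 := by
  set c := chartAt (EuclideanSpace ℝ (Fin d)) m with hc
  set k := chartAt (EuclideanSpace ℝ (Fin e)) (π m) with hk
  have hcm : m ∈ c.source := mem_chart_source _ m
  have hkm : π m ∈ k.source := mem_chart_source _ _
  have hct : c m ∈ c.target := c.map_source hcm
  have hcs : ∀ y ∈ c.target, MDifferentiableAt 𝓘(ℝ, EuclideanSpace ℝ (Fin d)) (𝓡 d) c.symm y :=
    fun y hy => (contMDiffAt_symm_of_mem_maximalAtlas
      (IsManifold.chart_mem_maximalAtlas (n := ∞) m) hy).mdifferentiableAt (by simp)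
  have hπd : ∀ x, MDifferentiableAt (𝓡 d) (𝓡 e) π x := fun x => (hπ x).mdifferentiableAt (by simp)
  let P : EuclideanSpace ℝ (Fin d) → EuclideanSpace ℝ (Fin e) := fun y => k (π (c.symm y))
  have hPs : ContDiffAt ℝ ∞ P (c m) := by
    apply ContMDiffAt.contDiffAt
    refine ContMDiffAt.comp (c m) (I' := 𝓡 e) (g := k) (f := fun y => π (c.symm y)) ?_ ?_
    · rw [c.left_inv hcm]
      exact contMDiffAt_of_mem_maximalAtlas (IsManifold.chart_mem_maximalAtlas _) hkm
    · exact (hπ _).comp _ (contMDiffAt_symm_of_mem_maximalAtlas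
        (IsManifold.chart_mem_maximalAtlas (n := ∞) m) hct)
  have hPm : P (c m) = k (π m) := by simp only [P, c.left_inv hcm]
  have hPd : ∀ y, y ∈ c.target → π (c.symm y) ∈ k.source → DifferentiableAt ℝ P y := by
    intro y hy hs
    have hkd : MDifferentiableAt (𝓡 e) 𝓘(ℝ, EuclideanSpace ℝ (Fin e)) k (π (c.symm y)) :=
      (contMDiffAt_of_mem_maximalAtlas (IsManifold.chart_mem_maximalAtlas (n := ∞) _)
        hs).mdifferentiableAt (by simp)
    exact (hkd.comp y ((hπd _).comp y (hcs y hy))).differentiableAt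
  have hev : θ.inChart m =ᶠ[𝓝 (c m)] fun y =>
      (ζ.inChart (π m) (P y)).compContinuousLinearMap (fderiv ℝ P y) +
        G (π (c.symm y)) • α.inChart m y := by
    have hcont : ContinuousAt (fun y => π (c.symm y)) (c m) :=
      (hπ.continuous.continuousAt).comp (c.continuousAt_symm hct)
    have hnear : ∀ᶠ y in 𝓝 (c m), π (c.symm y) ∈ k.source :=
      hcont.eventually (k.open_source.mem_nhds (by simpa only [c.left_inv hcm] using hkm))
    filter_upwards [c.open_target.mem_nhds hct, hnear] with y hy hs
    have hkl : k.symm (P y) = π (c.symm y) := k.left_inv hs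
    have hchain : ∀ v, mfderiv 𝓘(ℝ, EuclideanSpace ℝ (Fin e)) (𝓡 e) k.symm (P y)
        (fderiv ℝ P y v) = mfderiv (𝓡 d) (𝓡 e) π (c.symm y)
          (mfderiv 𝓘(ℝ, EuclideanSpace ℝ (Fin d)) (𝓡 d) c.symm y v) := by
      have hks : MDifferentiableAt 𝓘(ℝ, EuclideanSpace ℝ (Fin e)) (𝓡 e) k.symm (P y) :=
        (contMDiffAt_symm_of_mem_maximalAtlas (IsManifold.chart_mem_maximalAtlas (n := ∞) (π m))
          (k.map_source hs)).mdifferentiableAt (by simp)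
      have h1 := hks.hasMFDerivAt.comp y (hPd y hy hs).hasFDerivAt.hasMFDerivAt
      have h2 := (hπd _).hasMFDerivAt.comp y (hcs y hy).hasMFDerivAt
      have heq : π ∘ c.symm =ᶠ[𝓝 y] k.symm ∘ P := by
        filter_upwards [(hπ.continuous.continuousAt.comp (c.continuousAt_symm hy)).eventually
          (k.open_source.mem_nhds hs)] with z hz
        exact (k.left_inv hz).symm
      have h3 := hasMFDerivAt_unique (h1.congr_of_eventuallyEq heq) h2
      exact fun v => DFunLike.congr_fun h3 v
    ext v
    -- The base points `k.symm (P y)` and `π (c.symm y)` are only propositionally equal; since all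
    -- tangent spaces unfold to the same model space, the covectors can be compared on it.
    have hgen : ∀ x, x = π (c.symm y) → ∀ u : EuclideanSpace ℝ (Fin e),
        ζ x u = ζ (π (c.symm y)) u := by
      rintro _ rfl u
      rfl
    have h4 := congrArg (fun f => f (mfderiv 𝓘(ℝ, EuclideanSpace ℝ (Fin d)) (𝓡 d) c.symm y (v 0)))
      (hθ (c.symm y))
    refine h4.trans ?_
    refine congrArg (fun t : ℝ => t + G (π (c.symm y)) * α (c.symm y)
      (mfderiv 𝓘(ℝ, EuclideanSpace ℝ (Fin d)) (𝓡 d) c.symm y (v 0))) ?_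
    refine Eq.trans ?_ (hgen _ hkl _).symm
    exact congrArg (ζ (π (c.symm y))) (hchain (v 0)).symm
  have hG' : HasFDerivAt (fun y => G (π (c.symm y)))
      (0 : EuclideanSpace ℝ (Fin d) →L[ℝ] ℝ) (c m) := by
    have h1 : HasMFDerivAt (𝓡 e) 𝓘(ℝ, ℝ) G (π (c.symm (c m))) 0 := by
      rw [c.left_inv hcm, ← hdG]
      exact hG.hasMFDerivAt
    have h2 := h1.comp (c m) (((hπd _).comp (c m) (hcs _ hct)).hasMFDerivAt)
    rw [ContinuousLinearMap.zero_comp] at h2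
    exact hasMFDerivAt_iff_hasFDerivAt.1 h2
  have hd1 : DifferentiableAt ℝ (fun y =>
      (ζ.inChart (π m) (P y)).compContinuousLinearMap (fderiv ℝ P y)) (c m) := by
    refine DifferentiableAt.continuousAlternatingMapCompContinuousLinearMap ?_ ?_
    · rw [← hPm] at hζ
      exact hζ.comp (c m) (hPs.differentiableAt (by simp))
    · exact (hPs.fderiv_right (m := ∞) (by simp)).differentiableAt (by simp)
  -- Leibniz rule: one term carries `G`, the other `dG`, and both are zero here.
  have hd2 : HasFDerivAt (fun y => G (π (c.symm y)) • α.inChart m y)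
      (0 : EuclideanSpace ℝ (Fin d) →L[ℝ] _) (c m) := by
    have := hG'.smul hα.hasFDerivAt
    rw [c.left_inv hcm, hG0] at this
    refine this.congr_fderiv ?_
    ext v w
    simp
  rw [OneForm.extDeriv, hev.extDeriv_eq, extDeriv_fun_add hd1 hd2.differentiableAt,
    extDeriv_pullback (r := ∞) (by rw [hPm]; exact hζ) hPs (by simpa using
      (WithTop.coe_le_coe.2 le_top : ((2 : ℕ∞) : WithTop ℕ∞) ≤ ∞))]
  have hz : _root_.extDeriv (fun y => G (π (c.symm y)) • α.inChart m y) (c m) = 0 := by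
    rw [_root_.extDeriv, hd2.fderiv]
    ext v
    simp [ContinuousAlternatingMap.alternatizeUncurryFin_apply]
  rw [hz, add_zero]
  -- By the chain rule `dP ∘ dc = dk ∘ dπ`, so the pulled-back 2-form receives the zero vector in
  -- its first slot.
  have h1 := (hPs.differentiableAt (by simp)).hasFDerivAt.hasMFDerivAt.comp m
    (contMDiffAt_of_mem_maximalAtlas (IsManifold.chart_mem_maximalAtlas (I := 𝓡 d) (n := ∞) m)
        hcm |>.mdifferentiableAt (by simp)).hasMFDerivAt
  have h2 := (contMDiffAt_of_mem_maximalAtlas (IsManifold.chart_mem_maximalAtlas (I := 𝓡 e)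
    (n := ∞) (π m)) hkm |>.mdifferentiableAt (by simp)).hasMFDerivAt.comp m
      (hπd m).hasMFDerivAt
  have heq : k ∘ π =ᶠ[𝓝 m] P ∘ c := by
    filter_upwards [c.open_source.mem_nhds hcm] with z hz
    simp only [P, Function.comp, c.left_inv hz]
  have h3 := DFunLike.congr_fun (hasMFDerivAt_unique (h1.congr_of_eventuallyEq heq) h2) ξ
  refine ContinuousAlternatingMap.map_coord_zero (_root_.extDeriv (ζ.inChart (π m)) (P (c m)))
    (0 : Fin 2) ?_
  refine h3.trans ?_
  rw [ContinuousLinearMap.comp_apply, hξ, map_zero]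
  rfl

end ExteriorDerivative

/-! ### From the contact condition to nonvanishing differentials. -/

section Transversality

theorem OneForm.sum_smul_apply {d p : ℕ} {M : Type*} [TopologicalSpace M]
    [ChartedSpace (EuclideanSpace ℝ (Fin d)) M] (l : Fin p → ℝ) (Ω : Fin p → OneForm d M) (m : M)
    (v : TangentSpace (𝓡 d) m) : (∑ i, l i • Ω i) m v = ∑ i, l i * Ω i m v := by
  rw [Finset.sum_apply, _root_.sum_apply]
  rfl

variable {n p : ℕ} {B : Type*} [TopologicalSpace B]
  [ChartedSpace (EuclideanSpace ℝ (Fin (2 * n))) B]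
  {M : Type*} [TopologicalSpace M] [ChartedSpace (EuclideanSpace ℝ (Fin (2 * n + 1))) M]
  [MulAction Circle M] {π : M → B}

theorem IsPrincipalCircleBundle.surjective
    (hπ : IsPrincipalCircleBundle (d := 2 * n + 1) (e := 2 * n) π) : Function.Surjective π := by
  intro b
  obtain ⟨U, -, hbU, t, -, -, -, g, hg, -, hinv⟩ := hπ.locally_trivial b
  have hmem : (b, (1 : Circle)) ∈ U ×ˢ (Set.univ : Set Circle) := ⟨hbU, Set.mem_univ _⟩
  exact ⟨g (b, 1), congrArg Prod.fst (hinv.2 hmem)⟩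

variable [IsManifold (𝓡 (2 * n + 1)) ∞ M]

/-- The fundamental vector field of the circle action provides a vertical vector on which a
connection form is nonzero. -/
theorem IsConnectionForm.exists_vertical
    (hπ : IsPrincipalCircleBundle (d := 2 * n + 1) (e := 2 * n) π)
    {α : OneForm (2 * n + 1) M} (hα : IsConnectionForm α) (m : M) :
    ∃ ξ : TangentSpace (𝓡 (2 * n + 1)) m, ξ ≠ 0 ∧
      mfderiv (𝓡 (2 * n + 1)) (𝓡 (2 * n)) π m ξ = 0 := by
  have key : ∃ ξ : TangentSpace (𝓡 (2 * n + 1)) (Circle.exp 0 • m), ξ ≠ 0 ∧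
      mfderiv (𝓡 (2 * n + 1)) (𝓡 (2 * n)) π (Circle.exp 0 • m) ξ = 0 := by
    refine ⟨mfderiv 𝓘(ℝ, ℝ) (𝓡 (2 * n + 1)) (fun t : ℝ => Circle.exp t • m) 0 (1 : ℝ),
      fun h => one_ne_zero ((hα.fundamental m).symm.trans ?_), ?_⟩
    · rw [h, map_zero]
    · have hd : MDifferentiableAt 𝓘(ℝ, ℝ) (𝓡 (2 * n + 1)) (fun t : ℝ => Circle.exp t • m) 0 := by
        -- `mfderiv` is `0` at a point of nondifferentiability, which is incompatible with the
        -- normalization of `α` on the fundamental field.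
        by_contra hnd
        have h := hα.fundamental m
        rw [mfderiv_zero_of_not_mdifferentiableAt hnd] at h
        exact zero_ne_one (((α _).map_zero).symm.trans h)
      have hc := mfderiv_comp (0 : ℝ)
        ((hπ.smooth_proj (Circle.exp 0 • m)).mdifferentiableAt (by simp)) hd
      have hconst : (π ∘ fun t : ℝ => Circle.exp t • m) = fun _ => π m :=
        funext fun t => hπ.proj_smul _ _
      have h2 := DFunLike.congr_fun hc (1 : ℝ)
      refine h2.symm.trans ?_
      rw [hconst, mfderiv_const]
      rfl
  rwa [Circle.exp_zero, one_smul] at key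

variable [IsManifold (𝓡 (2 * n)) ∞ B]

/-- A zero of `G = ∑ lᵢ φᵢ` that is also critical would make a vertical vector a common kernel
vector of the contact form `∑ lᵢ Ωᵢ` and of its differential. -/
theorem IsContactSphere.mfderiv_ne_zero
    (hπ : IsPrincipalCircleBundle (d := 2 * n + 1) (e := 2 * n) π)
    {α : OneForm (2 * n + 1) M} (hα : IsConnectionForm α)
    {Ω : Fin (p + 1) → OneForm (2 * n + 1) M} (hΩ : IsContactSphere n Ω)
    {η : Fin (p + 1) → OneForm (2 * n) B} (hη : ∀ i, (η i).IsSmooth)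
    {φ : Fin (p + 1) → B → ℝ} (hφ : ∀ i, ContMDiff (𝓡 (2 * n)) 𝓘(ℝ, ℝ) ∞ (φ i))
    (hdec : ∀ i m, Ω i m = (η i).pullback π m + φ i (π m) • α m)
    (l : Fin (p + 1) → ℝ) (hl : ∑ i, l i ^ 2 = 1) (b : B) (hb : ∑ i, l i * φ i b = 0) :
    mfderiv (𝓡 (2 * n)) 𝓘(ℝ, ℝ) (fun x => ∑ i, l i * φ i x) b ≠ 0 := by
  intro hd
  obtain ⟨m, rfl⟩ := hπ.surjective b
  obtain ⟨ξ, hξ, hv⟩ := hα.exists_vertical hπ m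
  set θ : OneForm (2 * n + 1) M := ∑ i, l i • Ω i with hθ
  set ζ : OneForm (2 * n) B := ∑ i, l i • η i with hζ
  set G : B → ℝ := fun x => ∑ i, l i * φ i x with hG
  have hdec' : ∀ m', θ m' = ζ.pullback π m' + G (π m') • α m' := by
    intro m'
    ext v
    have h1 : ∀ i, Ω i m' v = η i (π m') (mfderiv (𝓡 (2 * n + 1)) (𝓡 (2 * n)) π m' v) +
        φ i (π m') * α m' v := fun i => DFunLike.congr_fun (hdec i m') v
    have h2 : (ζ.pullback π m' + G (π m') • α m' :
        TangentSpace (𝓡 (2 * n + 1)) m' →L[ℝ] ℝ) v =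
        ζ (π m') (mfderiv (𝓡 (2 * n + 1)) (𝓡 (2 * n)) π m' v) + G (π m') * α m' v := rfl
    rw [h2, hθ, hζ, OneForm.sum_smul_apply, OneForm.sum_smul_apply, hG, Finset.sum_mul,
      ← Finset.sum_add_distrib]
    refine Finset.sum_congr rfl fun i _ => ?_
    rw [h1]
    ring
  have hζd : DifferentiableAt ℝ (ζ.inChart (π m))
      (chartAt (EuclideanSpace ℝ (Fin (2 * n))) (π m) (π m)) := by
    have : ζ.inChart (π m) = fun y => ∑ i, l i • (η i).inChart (π m) y := by
      ext y v
      rw [ContinuousAlternatingMap.sum_apply]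
      exact OneForm.sum_smul_apply l η _ _
    rw [this]
    exact DifferentiableAt.fun_sum fun i _ =>
      ((hη i).differentiableAt_inChart (π m)).const_smul (l i)
  have hGd : MDifferentiableAt (𝓡 (2 * n)) 𝓘(ℝ, ℝ) G (π m) :=
    (contMDiff_finsetSum fun i _ => (contMDiff_const (c := l i)).mul (hφ i)).mdifferentiableAt
      (n := ∞) (by simp)
  obtain ⟨-, hcontact⟩ := hΩ θ ⟨l, hl, rfl⟩
  obtain ⟨v, hvne⟩ := hcontact m
  refine hvne (wedgePow_eq_zero_of_kernel n ?_ _ _ hξ ?_ (fun w => ?_) v)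
  · exact finrank_euclideanSpace_fin
  · rw [hdec', show G (π m) = 0 from hb, zero_smul, add_zero, OneForm.pullback,
      ContinuousLinearMap.comp_apply, hv, map_zero]
  · exact OneForm.extDeriv_apply_eq_zero hπ.smooth_proj m hζd (hα.smooth.differentiableAt_inChart m)
      hGd hb hd hdec' hv w

end Transversality

/-! ### A smooth implicit function theorem. -/

section Implicit

open Topology Filter

/-- Implicit function theorem for smooth functions, near a zero at which the partial derivative in
the second variable is the identity. -/
theorem exists_implicit_solution {P F : Type*} [NormedAddCommGroup P] [NormedSpace ℝ P]
    [CompleteSpace P] [NormedAddCommGroup F] [NormedSpace ℝ F] [CompleteSpace F] {H : P × F → F}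
    {p₀ : P} (hH : ∀ᶠ z in 𝓝 (p₀, (0 : F)), ContDiffAt ℝ ∞ H z) (h0 : H (p₀, 0) = 0)
    (hd : ∀ y, fderiv ℝ H (p₀, 0) (0, y) = y) :
    ∃ y : P → F, (∀ᶠ p in 𝓝 p₀, ContDiffAt ℝ ∞ y p) ∧ Tendsto y (𝓝 p₀) (𝓝 0) ∧
      ∀ᶠ z in 𝓝 (p₀, (0 : F)), H z = 0 ↔ y z.1 = z.2 := by
  have hne : (∞ : WithTop ℕ∞) ≠ 0 := by simp
  have hH0 := hH.self_of_nhds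
  have hid : fderiv ℝ H (p₀, 0) ∘L .inr ℝ P F = (ContinuousLinearEquiv.refl ℝ F : F →L[ℝ] F) := by
    ext y
    simp [hd]
  have hinv : (fderiv ℝ H (p₀, 0) ∘L .inr ℝ P F).IsInvertible := ⟨_, hid.symm⟩
  set y := hH0.implicitFunction hne hinv with hy
  have hy0 : y p₀ = 0 := hH0.implicitFunction_apply_self hne hinv
  have hys : ContDiffAt ℝ ∞ y p₀ := hH0.contDiffAt_implicitFunction hne hinv
  have hiff : ∀ᶠ z in 𝓝 (p₀, (0 : F)), H z = 0 ↔ y z.1 = z.2 := by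
    have := hH0.eventually_apply_eq_iff_implicitFunction hne hinv
    rwa [h0] at this
  have htend : Tendsto y (𝓝 p₀) (𝓝 0) := by
    have := hys.continuousAt.tendsto
    rwa [hy0] at this
  refine ⟨y, ?_, htend, hiff⟩
  -- `ContDiffAt ℝ ∞` at `p₀` alone does not provide a single neighbourhood of smoothness. The
  -- theorem is therefore applied again at each nearby `(p, y p)`, and uniqueness identifies the new
  -- solution with `y`.
  have hpair : Tendsto (fun p => (p, y p)) (𝓝 p₀) (𝓝 (p₀, (0 : F))) :=
    tendsto_id.prodMk_nhds htend
  have hcont : ∀ᶠ p in 𝓝 p₀, ContinuousAt y p := by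
    have h1 : ContDiffAt ℝ 1 y p₀ := hys.of_le (by exact_mod_cast le_top)
    exact (h1.eventually (by simp)).mono fun p hp => hp.continuousAt
  have hinvev : ∀ᶠ z in 𝓝 (p₀, (0 : F)), (fderiv ℝ H z ∘L .inr ℝ P F).IsInvertible := by
    have h1 : ContinuousAt (fun z => fderiv ℝ H z ∘L .inr ℝ P F) (p₀, (0 : F)) :=
      ((hH0.fderiv_right (m := ∞) (by simp)).continuousAt).clm_comp continuousAt_const
    have h2 := ContinuousLinearEquiv.nhds (ContinuousLinearEquiv.refl ℝ F)
    rw [← hid] at h2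
    exact (h1.eventually h2).mono fun z ⟨e, he⟩ => ⟨e, he⟩
  filter_upwards [hpair.eventually hH, hpair.eventually hinvev, hcont,
    hpair.eventually hiff.eventually_nhds] with p h1 h2 h3 h4
  have h5 := h1.contDiffAt_implicitFunction hne h2
  refine h5.congr_of_eventuallyEq ?_
  have hpz : H (p, y p) = 0 := h4.self_of_nhds.2 rfl
  have h6 := h1.eventually_apply_eq_iff_implicitFunction hne h2
  have hpair' : Tendsto (fun q => (q, y q)) (𝓝 p) (𝓝 (p, y p)) :=
    tendsto_id.prodMk_nhds h3
  filter_upwards [hpair'.eventually h6, hpair'.eventually h4] with q h7 h8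
  exact (h7.1 ((h8.2 rfl).trans hpz.symm)).symm

theorem eventually_implicit_solution {P F : Type*} [TopologicalSpace P] [TopologicalSpace F] [Zero F]
    {H : P × F → F} {p₀ : P} {y : P → F} (hy : Tendsto y (𝓝 p₀) (𝓝 0))
    (h : ∀ᶠ z in 𝓝 (p₀, (0 : F)), H z = 0 ↔ y z.1 = z.2) : ∀ᶠ p in 𝓝 p₀, H (p, y p) = 0 := by
  have hpair : Tendsto (fun p => (p, y p)) (𝓝 p₀) (𝓝 (p₀, (0 : F))) :=
    tendsto_id.prodMk_nhds hy
  filter_upwards [hpair.eventually h] with p hp using hp.2 rfl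

end Implicit

/-! ### Local families of maps: inverses and prescribed changes of `Φ`. -/

section LocalMoves

open Topology Filter

theorem fderiv_apply_inr_of_hasFDerivAt_id {P F : Type*} [NormedAddCommGroup P] [NormedSpace ℝ P]
    [NormedAddCommGroup F] [NormedSpace ℝ F] {H : P × F → F} {p₀ : P}
    (hH : DifferentiableAt ℝ H (p₀, 0))
    (h : HasFDerivAt (fun y => H (p₀, y)) (ContinuousLinearMap.id ℝ F) 0) (y : F) :
    fderiv ℝ H (p₀, 0) (0, y) = y := by
  have h1 : HasFDerivAt (fun y => H (p₀, y)) (fderiv ℝ H (p₀, 0) ∘L .inr ℝ P F) 0 :=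
    hH.hasFDerivAt.comp (0 : F) (hasFDerivAt_prodMk_right p₀ 0)
  simpa using DFunLike.congr_fun (h1.unique h) y

variable {d : ℕ} {B : Type*} [TopologicalSpace B] [ChartedSpace (EuclideanSpace ℝ (Fin d)) B]
  [IsManifold (𝓡 d) ∞ B] {W : Type*} [NormedAddCommGroup W] [NormedSpace ℝ W]

theorem contMDiffAt_comp_chartAt_symm {Z H' Y : Type*} [NormedAddCommGroup Z] [NormedSpace ℝ Z]
    [TopologicalSpace H'] {J : ModelWithCorners ℝ Z H'} [TopologicalSpace Y] [ChartedSpace H' Y]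
    {T : W × B → Y} {b₀ : B} {q : W × EuclideanSpace ℝ (Fin d)}
    (hq : q.2 ∈ (chartAt (EuclideanSpace ℝ (Fin d)) b₀).target)
    (hT : ContMDiffAt (𝓘(ℝ, W).prod (𝓡 d)) J ∞ T
      (q.1, (chartAt (EuclideanSpace ℝ (Fin d)) b₀).symm q.2)) :
    ContMDiffAt 𝓘(ℝ, W × EuclideanSpace ℝ (Fin d)) J ∞
      (fun q : W × EuclideanSpace ℝ (Fin d) =>
        T (q.1, (chartAt (EuclideanSpace ℝ (Fin d)) b₀).symm q.2)) q := by
  refine ContMDiffAt.comp q (f := fun q : W × EuclideanSpace ℝ (Fin d) =>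
    (q.1, (chartAt (EuclideanSpace ℝ (Fin d)) b₀).symm q.2)) hT ?_
  refine ContMDiffAt.prodMk contDiff_fst.contMDiff.contMDiffAt ?_
  exact ContMDiffAt.comp q (contMDiffAt_symm_of_mem_maximalAtlas
    (IsManifold.chart_mem_maximalAtlas b₀) hq) contDiff_snd.contMDiff.contMDiffAt

theorem contMDiffAt_comp_chartAt {Z : Type*} [NormedAddCommGroup Z] [NormedSpace ℝ Z]
    {y : W × EuclideanSpace ℝ (Fin d) → Z} {b₀ : B} {p : W × B}
    (hp : p.2 ∈ (chartAt (EuclideanSpace ℝ (Fin d)) b₀).source)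
    (hy : ContDiffAt ℝ ∞ y (p.1, chartAt (EuclideanSpace ℝ (Fin d)) b₀ p.2)) :
    ContMDiffAt (𝓘(ℝ, W).prod (𝓡 d)) 𝓘(ℝ, Z) ∞
      (fun p : W × B => y (p.1, chartAt (EuclideanSpace ℝ (Fin d)) b₀ p.2)) p := by
  refine ContMDiffAt.comp p (f := fun p : W × B =>
    (p.1, chartAt (EuclideanSpace ℝ (Fin d)) b₀ p.2)) hy.contMDiffAt ?_
  refine ContMDiffAt.prodMk_space contMDiff_fst.contMDiffAt ?_
  exact ContMDiffAt.comp p (contMDiffAt_of_mem_maximalAtlas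
    (IsManifold.chart_mem_maximalAtlas b₀) hp) contMDiff_snd.contMDiffAt

theorem eventually_contMDiffAt_chartAt_symm_comp {y : W × EuclideanSpace ℝ (Fin d) →
    EuclideanSpace ℝ (Fin d)} {w₀ : W} {b₀ : B}
    (hy : ∀ᶠ q in 𝓝 (w₀, chartAt (EuclideanSpace ℝ (Fin d)) b₀ b₀), ContDiffAt ℝ ∞ y q)
    (hy0 : y (w₀, chartAt (EuclideanSpace ℝ (Fin d)) b₀ b₀) =
      chartAt (EuclideanSpace ℝ (Fin d)) b₀ b₀) :
    ∀ᶠ p in 𝓝 (w₀, b₀), ContMDiffAt (𝓘(ℝ, W).prod (𝓡 d)) (𝓡 d) ∞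
      (fun p : W × B => (chartAt (EuclideanSpace ℝ (Fin d)) b₀).symm
        (y (p.1, chartAt (EuclideanSpace ℝ (Fin d)) b₀ p.2))) p := by
  set c := chartAt (EuclideanSpace ℝ (Fin d)) b₀ with hc
  have hcb : b₀ ∈ c.source := mem_chart_source _ _
  have hpair : Tendsto (fun p : W × B => (p.1, c p.2)) (𝓝 (w₀, b₀)) (𝓝 (w₀, c b₀)) :=
    (continuousAt_fst.prodMk ((c.continuousAt hcb).comp continuousAt_snd))
  have htar : ∀ᶠ q in 𝓝 (w₀, c b₀), y q ∈ c.target := by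
    refine hy.self_of_nhds.continuousAt.eventually ?_
    rw [hy0]
    exact c.open_target.mem_nhds (c.map_source hcb)
  filter_upwards [hpair.eventually hy, hpair.eventually htar,
    continuousAt_snd.eventually (c.open_source.mem_nhds hcb)] with p h1 h2 h3
  exact ContMDiffAt.comp p (contMDiffAt_symm_of_mem_maximalAtlas
    (IsManifold.chart_mem_maximalAtlas b₀) h2) (contMDiffAt_comp_chartAt h3 h1)

/-- A smooth family of maps starting at the identity has a local smooth inverse family. -/
theorem exists_local_inverse {T : W × B → B} [CompleteSpace W] (hT0 : ∀ b, T (0, b) = b) (b₀ : B)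
    (hT : ∀ᶠ p in 𝓝 ((0 : W), b₀), ContMDiffAt (𝓘(ℝ, W).prod (𝓡 d)) (𝓡 d) ∞ T p) :
    ∃ Q : W × B → B, ∀ᶠ p in 𝓝 ((0 : W), b₀),
      ContMDiffAt (𝓘(ℝ, W).prod (𝓡 d)) (𝓡 d) ∞ Q p ∧ T (p.1, Q p) = p.2 ∧
        Q (p.1, T p) = p.2 := by
  set c := chartAt (EuclideanSpace ℝ (Fin d)) b₀ with hc
  have hcb : b₀ ∈ c.source := mem_chart_source _ _
  have hct : c b₀ ∈ c.target := c.map_source hcb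
  -- In the chart, the unknown is the displacement `y` with `T(w, x + y) = x`; at `w = 0` the
  -- equation reads `y = 0`.
  let H : (W × EuclideanSpace ℝ (Fin d)) × EuclideanSpace ℝ (Fin d) → EuclideanSpace ℝ (Fin d) :=
    fun z => c (T (z.1.1, c.symm (z.1.2 + z.2))) - z.1.2
  have hTcont : ContinuousAt T (0, b₀) := hT.self_of_nhds.continuousAt
  have hTsrc : ∀ᶠ p in 𝓝 ((0 : W), b₀), T p ∈ c.source :=
    hTcont.eventually (by rw [hT0]; exact c.open_source.mem_nhds hcb)
  have hsum : Tendsto (fun z : (W × EuclideanSpace ℝ (Fin d)) × EuclideanSpace ℝ (Fin d) =>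
      (z.1.1, z.1.2 + z.2)) (𝓝 (((0 : W), c b₀), 0)) (𝓝 ((0 : W), c b₀)) := by
    have : Continuous (fun z : (W × EuclideanSpace ℝ (Fin d)) × EuclideanSpace ℝ (Fin d) =>
      (z.1.1, z.1.2 + z.2)) := by fun_prop
    simpa using this.tendsto (((0 : W), c b₀), 0)
  have hback : Tendsto (fun q : W × EuclideanSpace ℝ (Fin d) => (q.1, c.symm q.2))
      (𝓝 ((0 : W), c b₀)) (𝓝 ((0 : W), b₀)) := by
    have h := (continuousAt_fst (p := ((0 : W), c b₀))).prodMk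
      (ContinuousAt.comp (g := c.symm) (f := Prod.snd) (c.continuousAt_symm hct) continuousAt_snd)
    have h' := h.tendsto
    simpa only [Function.comp, c.left_inv hcb] using h'
  have hsnd : ∀ᶠ q in 𝓝 ((0 : W), c b₀), q.2 ∈ c.target :=
    continuousAt_snd.eventually (c.open_target.mem_nhds hct)
  have hH : ∀ᶠ z in 𝓝 (((0 : W), c b₀), (0 : EuclideanSpace ℝ (Fin d))), ContDiffAt ℝ ∞ H z := by
    filter_upwards [hsum.eventually (hback.eventually hT), hsum.eventually hsnd,
      hsum.eventually (hback.eventually hTsrc)] with z h1 h2 h3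
    have h4 := contMDiffAt_comp_chartAt_symm (b₀ := b₀) (q := (z.1.1, z.1.2 + z.2)) h2 h1
    have h5 : ContMDiffAt 𝓘(ℝ, W × EuclideanSpace ℝ (Fin d)) 𝓘(ℝ, EuclideanSpace ℝ (Fin d)) ∞
        (fun q : W × EuclideanSpace ℝ (Fin d) => c (T (q.1, c.symm q.2))) (z.1.1, z.1.2 + z.2) :=
      ContMDiffAt.comp (z.1.1, z.1.2 + z.2) (contMDiffAt_of_mem_maximalAtlas
        (IsManifold.chart_mem_maximalAtlas b₀) h3) h4
    have h6 : ContDiffAt ℝ ∞ (fun z : (W × EuclideanSpace ℝ (Fin d)) × EuclideanSpace ℝ (Fin d) =>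
        c (T (z.1.1, c.symm (z.1.2 + z.2)))) z :=
      h5.contDiffAt.comp z (f := fun z : (W × EuclideanSpace ℝ (Fin d)) ×
        EuclideanSpace ℝ (Fin d) => (z.1.1, z.1.2 + z.2)) (by fun_prop)
    exact h6.sub (by fun_prop)
  have h0 : H (((0 : W), c b₀), 0) = 0 := by
    simp [H, hT0, c.right_inv hct]
  have hd : HasFDerivAt (fun y => H (((0 : W), c b₀), y))
      (ContinuousLinearMap.id ℝ (EuclideanSpace ℝ (Fin d))) 0 := by
    refine (hasFDerivAt_id (0 : EuclideanSpace ℝ (Fin d))).congr_of_eventuallyEq ?_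
    have : Tendsto (fun y : EuclideanSpace ℝ (Fin d) => c b₀ + y) (𝓝 0) (𝓝 (c b₀)) := by
      have h : Continuous fun y : EuclideanSpace ℝ (Fin d) => c b₀ + y := by fun_prop
      simpa using h.tendsto 0
    filter_upwards [this.eventually (c.open_target.mem_nhds hct)] with y hy
    simp [H, hT0, c.right_inv hy]
  obtain ⟨y, hys, hyt, hyiff⟩ := exists_implicit_solution hH h0
    (fderiv_apply_inr_of_hasFDerivAt_id (hH.self_of_nhds.differentiableAt (by simp)) hd)
  have hysol := eventually_implicit_solution hyt hyiff
  have hy0 : y (0, c b₀) = 0 := (hyiff.self_of_nhds.1 h0)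
  have hfwd : Tendsto (fun p : W × B => (p.1, c p.2)) (𝓝 ((0 : W), b₀)) (𝓝 ((0 : W), c b₀)) :=
    (continuousAt_fst.prodMk ((c.continuousAt hcb).comp continuousAt_snd))
  refine ⟨fun p => c.symm (c p.2 + y (p.1, c p.2)), ?_⟩
  have hQ := eventually_contMDiffAt_chartAt_symm_comp (w₀ := (0 : W)) (b₀ := b₀)
    (y := fun q => q.2 + y q) (hys.mono fun q hq => contDiffAt_snd.add hq)
    (by simp only [← hc, hy0, add_zero])
  have hQ0 : c.symm (c b₀ + y (0, c b₀)) = b₀ := by rw [hy0, add_zero, c.left_inv hcb]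
  have hQt : Tendsto (fun p : W × B => (p.1, c.symm (c p.2 + y (p.1, c p.2))))
      (𝓝 ((0 : W), b₀)) (𝓝 ((0 : W), b₀)) := by
    have h := (continuousAt_fst (p := ((0 : W), b₀))).prodMk hQ.self_of_nhds.continuousAt
    have h' := h.tendsto
    simpa only [← hc, hQ0] using h'
  -- Over the point `T p` the displacement `c p.2 - c (T p)` is an obvious solution; uniqueness
  -- makes `Q` a left inverse too.
  have hTt : Tendsto (fun p : W × B => ((p.1, c (T p)), c p.2 - c (T p)))
      (𝓝 ((0 : W), b₀)) (𝓝 (((0 : W), c b₀), 0)) := by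
    have h1 : ContinuousAt (fun p : W × B => c (T p)) (0, b₀) :=
      ContinuousAt.comp (g := c) (by rw [hT0]; exact c.continuousAt hcb) hTcont
    have h2 : ContinuousAt (fun p : W × B => c p.2) (0, b₀) :=
      ContinuousAt.comp (g := c) (c.continuousAt hcb) continuousAt_snd
    have h := ((continuousAt_fst (p := ((0 : W), b₀))).prodMk h1).prodMk (h2.sub h1)
    have h' := h.tendsto
    simpa only [Pi.sub_apply, hT0, sub_self] using h'
  filter_upwards [hQ, hfwd.eventually hysol, hQt.eventually hTsrc, hTt.eventually hyiff,
    continuousAt_snd.eventually (c.open_source.mem_nhds hcb)] with p h1 h2 h3 h4 h5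
  refine ⟨h1, ?_, ?_⟩
  · exact c.injOn h3 h5 (sub_eq_zero.1 h2)
  · have h6 := h4.1 (by simp [H, c.left_inv h5])
    simp only [h6, add_sub_cancel, c.left_inv h5]

/-- Near a point where `(v, s) ↦ dΦ(v) + s Φ` is onto, points can be moved smoothly so that the
value of `Φ` changes in a prescribed way up to a positive factor. -/
theorem exists_local_move {F : Type*} [NormedAddCommGroup F] [NormedSpace ℝ F] [CompleteSpace F]
    [CompleteSpace W]
    {Φ : B → F} (hΦ : ContMDiff (𝓡 d) 𝓘(ℝ, F) ∞ Φ) {G : W × F → F} (hG : ContDiff ℝ ∞ G)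
    (hG0 : ∀ y, G (0, y) = y) {b₀ : B} {R₁ : F →L[ℝ] EuclideanSpace ℝ (Fin d)} {R₂ : F →L[ℝ] ℝ}
    (hR : ∀ y, fderiv ℝ (Φ ∘ (chartAt (EuclideanSpace ℝ (Fin d)) b₀).symm)
      (chartAt (EuclideanSpace ℝ (Fin d)) b₀ b₀) (R₁ y) + R₂ y • Φ b₀ = y) :
    ∃ S : W × B → B, ∀ᶠ p in 𝓝 ((0 : W), b₀),
      ContMDiffAt (𝓘(ℝ, W).prod (𝓡 d)) (𝓡 d) ∞ S p ∧
      (∃ r : ℝ, 0 < r ∧ (R₂ = 0 → r = 1) ∧ Φ (S p) = r • G (p.1, Φ p.2)) ∧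
      S (0, p.2) = p.2 := by
  set c := chartAt (EuclideanSpace ℝ (Fin d)) b₀ with hc
  have hcb : b₀ ∈ c.source := mem_chart_source _ _
  have hct : c b₀ ∈ c.target := c.map_source hcb
  set f := Φ ∘ c.symm with hf
  have hfs : ∀ x ∈ c.target, ContDiffAt ℝ ∞ f x := fun x hx =>
    ((hΦ _).comp x (contMDiffAt_symm_of_mem_maximalAtlas
      (IsManifold.chart_mem_maximalAtlas b₀) hx)).contDiffAt
  have hf0 : f (c b₀) = Φ b₀ := by simp only [hf, Function.comp, c.left_inv hcb]
  -- The unknown `y` governs both the displacement `R₁ y` and the factor `1 - R₂ y`, positive for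
  -- small `y`. By `hR` the partial derivative in `y` is the identity.
  let H : (W × EuclideanSpace ℝ (Fin d)) × F → F :=
    fun z => f (z.1.2 + R₁ z.2) - (1 - R₂ z.2) • G (z.1.1, f z.1.2)
  have ht1 : Tendsto (fun z : (W × EuclideanSpace ℝ (Fin d)) × F => z.1.2 + R₁ z.2)
      (𝓝 (((0 : W), c b₀), 0)) (𝓝 (c b₀)) := by
    have : Continuous (fun z : (W × EuclideanSpace ℝ (Fin d)) × F => z.1.2 + R₁ z.2) := by fun_prop
    simpa using this.tendsto (((0 : W), c b₀), 0)
  have ht2 : Tendsto (fun z : (W × EuclideanSpace ℝ (Fin d)) × F => z.1.2)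
      (𝓝 (((0 : W), c b₀), 0)) (𝓝 (c b₀)) := by
    have : Continuous (fun z : (W × EuclideanSpace ℝ (Fin d)) × F => z.1.2) := by fun_prop
    exact this.tendsto (((0 : W), c b₀), 0)
  have hH : ∀ᶠ z in 𝓝 (((0 : W), c b₀), (0 : F)), ContDiffAt ℝ ∞ H z := by
    filter_upwards [ht1.eventually (c.open_target.mem_nhds hct),
      ht2.eventually (c.open_target.mem_nhds hct)] with z h1 h2
    have h3 : ContDiffAt ℝ ∞ (fun z : (W × EuclideanSpace ℝ (Fin d)) × F => f (z.1.2 + R₁ z.2)) z :=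
      (hfs _ h1).comp z (f := fun z : (W × EuclideanSpace ℝ (Fin d)) × F => z.1.2 + R₁ z.2)
        (by fun_prop)
    have h4 : ContDiffAt ℝ ∞ (fun z : (W × EuclideanSpace ℝ (Fin d)) × F => f z.1.2) z :=
      (hfs _ h2).comp z (f := fun z : (W × EuclideanSpace ℝ (Fin d)) × F => z.1.2)
        (by fun_prop)
    have h5 : ContDiffAt ℝ ∞
        (fun z : (W × EuclideanSpace ℝ (Fin d)) × F => G (z.1.1, f z.1.2)) z :=
      hG.contDiffAt.comp z (f := fun z : (W × EuclideanSpace ℝ (Fin d)) × F => (z.1.1, f z.1.2))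
        (ContDiffAt.prodMk (by fun_prop) h4)
    exact h3.sub (ContDiffAt.smul (by fun_prop) h5)
  have hzero : ∀ x, H (((0 : W), x), 0) = 0 := fun x => by simp [H, hG0]
  have hd : HasFDerivAt (fun y => H (((0 : W), c b₀), y)) (ContinuousLinearMap.id ℝ F) 0 := by
    have h1 : HasFDerivAt f (fderiv ℝ f (c b₀)) (c b₀ + R₁ 0) := by
      rw [map_zero, add_zero]
      exact ((hfs _ hct).differentiableAt (by simp)).hasFDerivAt
    have h2 := h1.comp (0 : F) (R₁.hasFDerivAt.const_add (c b₀))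
    have h3 := ((R₂.hasFDerivAt (x := (0 : F))).const_sub 1).smul_const (Φ b₀)
    have h4 := h2.sub h3
    refine (h4.congr_fderiv ?_).congr_of_eventuallyEq (Eventually.of_forall fun y => ?_)
    · ext y
      simpa using hR y
    · simp [H, hG0, hf0]
  obtain ⟨y, hys, hyt, hyiff⟩ := exists_implicit_solution hH (hzero _)
    (fderiv_apply_inr_of_hasFDerivAt_id (hH.self_of_nhds.differentiableAt (by simp)) hd)
  have hysol := eventually_implicit_solution hyt hyiff
  have hy0 : y (0, c b₀) = 0 := (hyiff.self_of_nhds.1 (hzero _))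
  have hfwd : Tendsto (fun p : W × B => (p.1, c p.2)) (𝓝 ((0 : W), b₀)) (𝓝 ((0 : W), c b₀)) :=
    (continuousAt_fst.prodMk ((c.continuousAt hcb).comp continuousAt_snd))
  refine ⟨fun p => c.symm (c p.2 + R₁ (y (p.1, c p.2))), ?_⟩
  have hS := eventually_contMDiffAt_chartAt_symm_comp (w₀ := (0 : W)) (b₀ := b₀)
    (y := fun q => q.2 + R₁ (y q)) (hys.mono fun q hq =>
      contDiffAt_snd.add (R₁.contDiff.contDiffAt.comp q hq))
    (by simp only [← hc, hy0, map_zero, add_zero])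
  have hpos : ∀ᶠ q in 𝓝 ((0 : W), c b₀), 0 < 1 - R₂ (y q) := by
    have h1 : Tendsto (fun q => 1 - R₂ (y q)) (𝓝 ((0 : W), c b₀)) (𝓝 (1 - R₂ 0)) :=
      tendsto_const_nhds.sub ((R₂.continuous.tendsto 0).comp hyt)
    exact h1.eventually (lt_mem_nhds (by simp))
  -- For `w = 0` the zero displacement is a solution at every base point, so by uniqueness `S(0, ·)`
  -- is the identity near `b₀`.
  have hz0 : Tendsto (fun p : W × B => (((0 : W), c p.2), (0 : F)))
      (𝓝 ((0 : W), b₀)) (𝓝 (((0 : W), c b₀), 0)) := by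
    have h2 : ContinuousAt (fun p : W × B => c p.2) (0, b₀) :=
      ContinuousAt.comp (g := c) (c.continuousAt hcb) continuousAt_snd
    exact ((continuousAt_const.prodMk h2).prodMk continuousAt_const).tendsto
  filter_upwards [hS, hfwd.eventually hysol, hfwd.eventually hpos, hz0.eventually hyiff,
    continuousAt_snd.eventually (c.open_source.mem_nhds hcb)] with p h1 h2 h3 h4 h5
  refine ⟨h1, ⟨1 - R₂ (y (p.1, c p.2)), h3, fun h => by simp [h], ?_⟩, ?_⟩
  · have h6 := sub_eq_zero.1 h2
    simpa only [hf, Function.comp, c.left_inv h5] using h6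
  · have h6 : y (0, c p.2) = 0 := h4.1 (hzero _)
    simp only [h6, map_zero, add_zero, c.left_inv h5]

end LocalMoves

/-! ### Patching local families over a compact manifold. -/

section GlobalMoves

open Topology Filter

variable {d : ℕ} {B : Type*} [TopologicalSpace B] [ChartedSpace (EuclideanSpace ℝ (Fin d)) B]
  {W : Type*} [NormedAddCommGroup W] [NormedSpace ℝ W]

/-- Compactness of `B` and `B × B` gives bijectivity of `T(w, ·)` for all small `w`: near the
diagonal a local inverse gives injectivity, off it continuity and separation do. The set-theoretic
inverse then agrees with the smooth local ones. -/
theorem exists_global_inverse [IsManifold (𝓡 d) ∞ B] [CompactSpace B] [T2Space B]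
    [CompleteSpace W] {T : W × B → B} (hT0 : ∀ b, T (0, b) = b)
    (hT : ∀ b, ∀ᶠ p in 𝓝 ((0 : W), b), ContMDiffAt (𝓘(ℝ, W).prod (𝓡 d)) (𝓡 d) ∞ T p) :
    ∃ T' : W × B → B, (∀ b, T' (0, b) = b) ∧ ∀ᶠ w in 𝓝 (0 : W), ∀ b,
      ContMDiffAt (𝓘(ℝ, W).prod (𝓡 d)) (𝓡 d) ∞ T' (w, b) ∧ T (w, T' (w, b)) = b ∧
        T' (w, T (w, b)) = b := by
  choose Q hQ using fun b => exists_local_inverse hT0 b (hT b)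
  have hinj : ∀ᶠ w in 𝓝 (0 : W), ∀ z ∈ (Set.univ : Set (B × B)),
      T (w, z.1) = T (w, z.2) → z.1 = z.2 := by
    refine isCompact_univ.eventually_forall_of_forall_eventually fun z _ => ?_
    obtain ⟨b, b'⟩ := z
    have h1 : Tendsto (fun z : W × B × B => (z.1, z.2.1)) (𝓝 ((0 : W), b, b'))
        (𝓝 ((0 : W), b)) :=
      Continuous.tendsto (by fun_prop : Continuous fun z : W × B × B => (z.1, z.2.1)) (0, b, b')
    have h2 : Tendsto (fun z : W × B × B => (z.1, z.2.2)) (𝓝 ((0 : W), b, b'))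
        (𝓝 ((0 : W), b')) :=
      Continuous.tendsto (by fun_prop : Continuous fun z : W × B × B => (z.1, z.2.2)) (0, b, b')
    by_cases hbb : b = b'
    · subst hbb
      filter_upwards [h1.eventually (hQ b), h2.eventually (hQ b)] with z h3 h4 h5
      have h6 := h3.2.2
      rw [h5, h4.2.2] at h6
      exact h6.symm
    · have hc : ∀ b, ContinuousAt T (0, b) := fun b => (hT b).self_of_nhds.continuousAt
      have h3 : Tendsto (fun z : W × B × B => T (z.1, z.2.1)) (𝓝 ((0 : W), b, b')) (𝓝 b) := by
        have := (hc b).tendsto.comp h1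
        rwa [hT0] at this
      have h4 : Tendsto (fun z : W × B × B => T (z.1, z.2.2)) (𝓝 ((0 : W), b, b')) (𝓝 b') := by
        have := (hc b').tendsto.comp h2
        rwa [hT0] at this
      filter_upwards [(h3.prodMk_nhds h4).eventually
        (isOpen_ne_fun continuous_fst continuous_snd |>.mem_nhds hbb)]
        with z hz h
      exact absurd h hz
  have hsurj : ∀ᶠ w in 𝓝 (0 : W), ∀ b ∈ (Set.univ : Set B), ∃ b', T (w, b') = b := by
    refine isCompact_univ.eventually_forall_of_forall_eventually fun b _ => ?_
    filter_upwards [hQ b] with p hp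
    exact ⟨Q b p, hp.2.1⟩
  classical
  let T' : W × B → B := fun p =>
    if h : ∃ b', T (p.1, b') = p.2 then h.choose else p.2
  have hT' : ∀ p : W × B, (∃ b', T (p.1, b') = p.2) → T (p.1, T' p) = p.2 := by
    intro p h
    simp only [T', dif_pos h]
    exact h.choose_spec
  have hsm : ∀ᶠ w in 𝓝 (0 : W), ∀ b ∈ (Set.univ : Set B),
      ContMDiffAt (𝓘(ℝ, W).prod (𝓡 d)) (𝓡 d) ∞ T' (w, b) := by
    refine isCompact_univ.eventually_forall_of_forall_eventually fun b _ => ?_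
    have heq : ∀ᶠ p in 𝓝 ((0 : W), b), T' p = Q b p := by
      filter_upwards [hQ b, (continuousAt_fst (p := ((0 : W), b))).eventually hinj] with p h1 h2
      exact h2 (T' p, Q b p) (Set.mem_univ _) ((hT' p ⟨_, h1.2.1⟩).trans h1.2.1.symm)
    filter_upwards [heq.eventually_nhds, hQ b] with p h1 h2
    exact h2.1.congr_of_eventuallyEq h1
  have hall : ∀ᶠ w in 𝓝 (0 : W), ∀ b,
      ContMDiffAt (𝓘(ℝ, W).prod (𝓡 d)) (𝓡 d) ∞ T' (w, b) ∧ T (w, T' (w, b)) = b ∧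
        T' (w, T (w, b)) = b := by
    filter_upwards [hinj, hsurj, hsm] with w h1 h2 h3 b
    exact ⟨h3 b trivial, hT' (w, b) (h2 b trivial),
      h1 (_, _) trivial (hT' (w, T (w, b)) ⟨b, rfl⟩)⟩
  refine ⟨T', fun b => ?_, hall⟩
  have := (hall.self_of_nhds b).2.1
  rwa [hT0] at this

/-- Local moves are composed, the `i`-th with parameter `ρ i b • w`. The cutoffs are evaluated at
the initial point `b`, not at the moved one, so the parameters add up to `(∑ ρ i b) • w`. -/
theorem exists_move_finset {Rel : W → B → B → Prop} (hrefl : ∀ b, Rel 0 b b)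
    (htrans : ∀ w₁ w₂ b₁ b₂ b₃, Rel w₁ b₁ b₂ → Rel w₂ b₂ b₃ → Rel (w₁ + w₂) b₁ b₃)
    {ι : Type*} {ρ : ι → B → ℝ} (hρ : ∀ i, ContMDiff (𝓡 d) 𝓘(ℝ, ℝ) ∞ (ρ i)) {S : ι → W × B → B}
    (hS : ∀ i, ∀ b ∈ tsupport (ρ i), ∀ᶠ p in 𝓝 ((0 : W), b),
      ContMDiffAt (𝓘(ℝ, W).prod (𝓡 d)) (𝓡 d) ∞ (S i) p ∧ Rel p.1 p.2 (S i p) ∧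
        S i (0, p.2) = p.2) (s : Finset ι) :
    ∃ T : W × B → B, (∀ b, T (0, b) = b) ∧ ∀ b, ∀ᶠ p in 𝓝 ((0 : W), b),
      ContMDiffAt (𝓘(ℝ, W).prod (𝓡 d)) (𝓡 d) ∞ T p ∧ Rel ((∑ i ∈ s, ρ i p.2) • p.1) p.2 (T p) := by
  classical
  induction s using Finset.induction_on with
  | empty => exact ⟨Prod.snd, fun b => rfl, fun b => Eventually.of_forall fun p =>
      ⟨contMDiffAt_snd, by simpa using hrefl p.2⟩⟩
  | insert i s his ih =>
    obtain ⟨T, hT0, hT⟩ := ih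
    -- Off the support of `ρ i` nothing is known about `S i`, hence the case distinction; near the
    -- support and for small parameters `S i (0, ·)` is the identity, so both branches agree.
    let T' : W × B → B := fun p => if ρ i p.2 = 0 then T p else S i (ρ i p.2 • p.1, T p)
    refine ⟨T', fun b => ?_, fun b => ?_⟩
    · by_cases h : ρ i b = 0
      · simp only [T', h, if_true, hT0]
      · have hb : b ∈ tsupport (ρ i) := subset_tsupport _ h
        simp only [T', h, if_false, smul_zero, hT0]
        exact (hS i b hb).self_of_nhds.2.2
    · by_cases hb : b ∈ tsupport (ρ i)
      · have hTc : ContinuousAt T (0, b) := (hT b).self_of_nhds.1.continuousAt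
        have hΨ : Tendsto (fun p : W × B => (ρ i p.2 • p.1, T p)) (𝓝 ((0 : W), b))
            (𝓝 ((0 : W), b)) := by
          have h1 : ContinuousAt (fun p : W × B => ρ i p.2 • p.1) (0, b) :=
            (((hρ i).continuous.comp continuous_snd).smul continuous_fst).continuousAt
          have h := (h1.prodMk hTc).tendsto
          simpa only [smul_zero, hT0] using h
        have heq : ∀ᶠ p in 𝓝 ((0 : W), b), T' p = S i (ρ i p.2 • p.1, T p) := by
          filter_upwards [hΨ.eventually (hS i b hb)] with p hp
          by_cases h : ρ i p.2 = 0
          · have := hp.2.2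
            simp only [T', h, if_true, zero_smul]
            exact this.symm
          · simp only [T', h, if_false]
        filter_upwards [hT b, hΨ.eventually (hS i b hb), heq.eventually_nhds] with p h1 h2 h3
        refine ⟨?_, ?_⟩
        · refine ContMDiffAt.congr_of_eventuallyEq ?_ h3
          refine ContMDiffAt.comp p (f := fun p : W × B => (ρ i p.2 • p.1, T p)) h2.1 ?_
          exact ((((hρ i).comp contMDiff_snd).contMDiffAt).smul contMDiffAt_fst).prodMk h1.1
        · rw [h3.self_of_nhds, Finset.sum_insert his, add_comm, add_smul]
          exact htrans _ _ _ _ _ h1.2 h2.2.1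
      · have hev : ∀ᶠ p in 𝓝 ((0 : W), b), ρ i p.2 = 0 := by
          filter_upwards [(continuousAt_snd (p := ((0 : W), b))).eventually
            ((isClosed_tsupport (ρ i)).isOpen_compl.mem_nhds hb)] with p hp
          exact image_eq_zero_of_notMem_tsupport hp
        have heq : ∀ᶠ p in 𝓝 ((0 : W), b), T' p = T p := by
          filter_upwards [hev] with p hp
          simp only [T', hp, if_true]
        filter_upwards [hT b, hev, heq.eventually_nhds] with p h1 h2 h3
        refine ⟨h1.1.congr_of_eventuallyEq h3, ?_⟩
        rw [h3.self_of_nhds, Finset.sum_insert his, h2, zero_add]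
        exact h1.2

/-- Local smooth moves realizing a relation which is additive in the parameter can be patched to a
global one by a partition of unity. -/
theorem exists_global_move [IsManifold (𝓡 d) ∞ B] [CompactSpace B] [T2Space B]
    {Rel : W → B → B → Prop} (hrefl : ∀ b, Rel 0 b b)
    (htrans : ∀ w₁ w₂ b₁ b₂ b₃, Rel w₁ b₁ b₂ → Rel w₂ b₂ b₃ → Rel (w₁ + w₂) b₁ b₃)
    {K : Set B} (hK : IsClosed K)
    (hloc : ∀ b ∈ K, ∃ S : W × B → B, ∀ᶠ p in 𝓝 ((0 : W), b),
      ContMDiffAt (𝓘(ℝ, W).prod (𝓡 d)) (𝓡 d) ∞ S p ∧ Rel p.1 p.2 (S p) ∧ S (0, p.2) = p.2) :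
    ∃ T : W × B → B, (∀ b, T (0, b) = b) ∧
      ∀ᶠ w in 𝓝 (0 : W), ∀ b, (ContMDiffAt (𝓘(ℝ, W).prod (𝓡 d)) (𝓡 d) ∞ T (w, b)) ∧
        (b ∈ K → Rel w b (T (w, b))) := by
  choose S hS using fun b : K => hloc b b.2
  -- The points at which a given local move works form an open set, so finitely many moves suffice.
  let U : K → Set B := fun b => {x | ∀ᶠ p in 𝓝 ((0 : W), x),
    ContMDiffAt (𝓘(ℝ, W).prod (𝓡 d)) (𝓡 d) ∞ (S b) p ∧ Rel p.1 p.2 (S b p) ∧ S b (0, p.2) = p.2}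
  have hUo : ∀ b, IsOpen (U b) := fun b =>
    isOpen_setOfPred_eventually_nhds.preimage (by fun_prop : Continuous fun x : B => ((0 : W), x))
  obtain ⟨t, ht⟩ := hK.isCompact.elim_finite_subcover U hUo
    (fun b hb => Set.mem_iUnion.2 ⟨⟨b, hb⟩, hS ⟨b, hb⟩⟩)
  obtain ⟨f, hf⟩ := SmoothPartitionOfUnity.exists_isSubordinate (𝓡 d) hK
    (fun i : t => U i) (fun i => hUo i) (by
      intro b hb
      obtain ⟨i, hi, hbi⟩ := Set.mem_iUnion₂.1 (ht hb)
      exact Set.mem_iUnion.2 ⟨⟨i, hi⟩, hbi⟩)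
  obtain ⟨T, hT0, hT⟩ := exists_move_finset hrefl htrans (ρ := fun i : t => f i)
    (fun i => (f i).contMDiff) (S := fun i : t => S i) (fun i b hb => hf i hb) Finset.univ
  refine ⟨T, hT0, ?_⟩
  have := isCompact_univ.eventually_forall_of_forall_eventually (x₀ := (0 : W))
    (P := fun w b => ContMDiffAt (𝓘(ℝ, W).prod (𝓡 d)) (𝓡 d) ∞ T (w, b) ∧
      Rel ((∑ i : t, f i b) • w) b (T (w, b))) (fun b _ => hT b)
  filter_upwards [this] with w hw b
  refine ⟨(hw b trivial).1, fun hb => ?_⟩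
  have h1 := (hw b trivial).2
  rwa [← finsum_eq_sum_of_fintype, f.sum_eq_one hb, one_smul] at h1

end GlobalMoves

/-! ### Radial transversality and the zero set as a submanifold. -/

section Fibration

open Topology Filter

variable {d k : ℕ} {B : Type*} [TopologicalSpace B] [ChartedSpace (EuclideanSpace ℝ (Fin d)) B]

/-- A map `Φ` to a Euclidean space is radially transverse if, at every point, the image of its
differential together with its value spans the target. -/
def IsRadiallyTransverse (Φ : B → EuclideanSpace ℝ (Fin k)) : Prop :=
  ∀ b l, l ≠ 0 → inner ℝ l (Φ b) = 0 → ∃ v, inner ℝ l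
    (fderiv ℝ (Φ ∘ (chartAt (EuclideanSpace ℝ (Fin d)) b).symm)
      (chartAt (EuclideanSpace ℝ (Fin d)) b b) v) ≠ 0

/-- The range of `(v, s) ↦ dΦ(v) + s Φ` has trivial orthogonal complement, so this map is onto; `R₁`
and `R₂` are the components of a linear section. -/
theorem IsRadiallyTransverse.exists_rightInverse {Φ : B → EuclideanSpace ℝ (Fin k)}
    (hΦ : IsRadiallyTransverse (d := d) Φ) (b : B) :
    ∃ (R₁ : EuclideanSpace ℝ (Fin k) →L[ℝ] EuclideanSpace ℝ (Fin d))
      (R₂ : EuclideanSpace ℝ (Fin k) →L[ℝ] ℝ), ∀ y,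
        fderiv ℝ (Φ ∘ (chartAt (EuclideanSpace ℝ (Fin d)) b).symm)
          (chartAt (EuclideanSpace ℝ (Fin d)) b b) (R₁ y) + R₂ y • Φ b = y := by
  set L := fderiv ℝ (Φ ∘ (chartAt (EuclideanSpace ℝ (Fin d)) b).symm)
          (chartAt (EuclideanSpace ℝ (Fin d)) b b) with hL
  let A : EuclideanSpace ℝ (Fin d) × ℝ →L[ℝ] EuclideanSpace ℝ (Fin k) :=
    L.coprod ((ContinuousLinearMap.id ℝ ℝ).smulRight (Φ b))
  have hA : ∀ v s, A (v, s) = L v + s • Φ b := fun v s => by simp [A]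
  have hsurj : LinearMap.range (A : EuclideanSpace ℝ (Fin d) × ℝ →ₗ[ℝ] EuclideanSpace ℝ (Fin k)) =
      ⊤ := by
    rw [← Submodule.orthogonal_eq_bot_iff, Submodule.eq_bot_iff]
    intro l hl
    by_contra hne
    have h1 : ∀ v s, inner ℝ l (L v + s • Φ b) = 0 := fun v s => by
      rw [← hA]
      exact (Submodule.mem_orthogonal' _ _).1 hl _ ⟨(v, s), rfl⟩
    obtain ⟨v, hv⟩ := hΦ b l hne (by simpa using h1 0 1)
    exact hv (by simpa using h1 v 0)
  obtain ⟨R, hR⟩ := LinearMap.exists_rightInverse_of_surjective _ hsurj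
  refine ⟨(ContinuousLinearMap.fst ℝ _ _).comp (LinearMap.toContinuousLinearMap R),
    (ContinuousLinearMap.snd ℝ _ _).comp (LinearMap.toContinuousLinearMap R), fun y => ?_⟩
  have h := DFunLike.congr_fun hR y
  have h' : A (R y) = y := h
  rw [← Prod.mk.eta (p := R y), hA] at h'
  exact h'

/-- Inverse function theorem with the source shrunk to points where `f` is smooth with invertible
derivative, so that the inverse is smooth on its whole domain. -/
theorem exists_smooth_openPartialHomeomorph {E : Type*} [NormedAddCommGroup E] [NormedSpace ℝ E]
    [CompleteSpace E] {f : E → E} {a : E} (hf : ∀ᶠ x in 𝓝 a, ContDiffAt ℝ ∞ f x)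
    (hd : HasFDerivAt f (ContinuousLinearMap.id ℝ E) a) :
    ∃ e : OpenPartialHomeomorph E E, a ∈ e.source ∧ (∀ x, e x = f x) ∧
      ContDiffOn ℝ ∞ e e.source ∧ ContDiffOn ℝ ∞ e.symm e.target := by
  have hne : (∞ : WithTop ℕ∞) ≠ 0 := by simp
  have hfa := hf.self_of_nhds
  have hd' : HasFDerivAt f (ContinuousLinearEquiv.refl ℝ E : E →L[ℝ] E) a := hd
  have hinv : ∀ᶠ x in 𝓝 a, ∃ e : E ≃L[ℝ] E, (e : E →L[ℝ] E) = fderiv ℝ f x := by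
    have h1 : ContinuousAt (fun x => fderiv ℝ f x) a :=
      (hfa.fderiv_right (m := ∞) (by simp)).continuousAt
    have h2 := ContinuousLinearEquiv.nhds (ContinuousLinearEquiv.refl ℝ E)
    rw [← hd'.fderiv] at h2
    exact (h1.eventually h2)
  obtain ⟨s, hs, hso, has⟩ := eventually_nhds_iff.1 (hf.and hinv)
  let e := (hfa.toOpenPartialHomeomorph f hd' hne).restrOpen s hso
  have hes : ∀ x ∈ e.source, x ∈ s := fun x hx => by
    rw [OpenPartialHomeomorph.restrOpen_source] at hx
    exact hx.2
  refine ⟨e, ?_, fun x => rfl, fun x hx => ?_, fun y hy => ?_⟩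
  · rw [OpenPartialHomeomorph.restrOpen_source]
    exact ⟨hfa.mem_toOpenPartialHomeomorph_source hd' hne, has⟩
  · exact (hs x (hes x hx)).1.contDiffWithinAt
  · obtain ⟨h1, g, hg⟩ := hs _ (hes _ (e.map_target hy))
    refine (e.contDiffAt_symm hy (f₀' := g) ?_ h1).contDiffWithinAt
    rw [hg]
    exact (h1.differentiableAt hne).hasFDerivAt

theorem isClosedSubmanifold_zero [IsManifold (𝓡 d) ∞ B] {Φ : B → EuclideanSpace ℝ (Fin k)}
    (hΦ : ContMDiff (𝓡 d) (𝓡 k) ∞ Φ) (ht : IsRadiallyTransverse (d := d) Φ) :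
    IsClosedSubmanifold d k {b | Φ b = 0} := by
  refine ⟨isClosed_eq hΦ.continuous continuous_const, fun z hz => ?_⟩
  obtain ⟨R, R₂, hR⟩ := ht.exists_rightInverse z
  set c := chartAt (EuclideanSpace ℝ (Fin d)) z with hc
  have hcz : z ∈ c.source := mem_chart_source _ _
  set f := Φ ∘ c.symm with hf
  set L := fderiv ℝ f (c z) with hL
  have hz' : Φ z = 0 := hz
  have hRL : ∀ y, L (R y) = y := fun y => by simpa [hz'] using hR y
  have hfs : ∀ x ∈ c.target, ContDiffAt ℝ ∞ f x := fun x hx =>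
    ((hΦ _).comp x (contMDiffAt_symm_of_mem_maximalAtlas
      (IsManifold.chart_mem_maximalAtlas z) hx)).contDiffAt
  -- At a zero of `Φ` the radial term drops out, so `R` is a right inverse of `L`. This correction
  -- gives `L ∘ ψ = f` and derivative the identity: `ψ` straightens the zero set to `ker L`.
  let ψ : EuclideanSpace ℝ (Fin d) → EuclideanSpace ℝ (Fin d) := fun x => x + R (f x - L x)
  have hψ : ∀ x, L (ψ x) = f x := fun x => by simp [ψ, hRL]
  have hψs : ∀ᶠ x in 𝓝 (c z), ContDiffAt ℝ ∞ ψ x := by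
    filter_upwards [c.open_target.mem_nhds (c.map_source hcz)] with x hx
    exact contDiffAt_id.add (R.contDiff.contDiffAt.comp x ((hfs x hx).sub L.contDiff.contDiffAt))
  have hψd : HasFDerivAt ψ (ContinuousLinearMap.id ℝ _) (c z) := by
    have h1 : HasFDerivAt f L (c z) :=
      ((hfs _ (c.map_source hcz)).differentiableAt (by simp)).hasFDerivAt
    have h2 := (hasFDerivAt_id (c z)).add (R.hasFDerivAt.comp (c z) (h1.sub L.hasFDerivAt))
    refine h2.congr_fderiv ?_
    simp
  obtain ⟨e, hze, hee, hes, het⟩ := exists_smooth_openPartialHomeomorph hψs hψd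
  refine ⟨c.trans e, ?_, ?_,
    LinearMap.ker (L : EuclideanSpace ℝ (Fin d) →ₗ[ℝ] EuclideanSpace ℝ (Fin k)), ?_, ?_⟩
  · have hcm : c ∈ IsManifold.maximalAtlas (𝓡 d) ∞ B := IsManifold.chart_mem_maximalAtlas z
    refine (c.trans e).mem_maximalAtlas_of_contMDiffOn ?_ ?_
    · rw [OpenPartialHomeomorph.coe_trans]
      refine hes.contMDiffOn.comp ((contMDiffOn_of_mem_maximalAtlas hcm).mono ?_) ?_ <;>
        intro x hx <;> rw [OpenPartialHomeomorph.trans_source] at hx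
      exacts [hx.1, hx.2]
    · rw [OpenPartialHomeomorph.coe_trans_symm]
      refine (contMDiffOn_symm_of_mem_maximalAtlas hcm).comp (het.contMDiffOn.mono ?_) ?_ <;>
        intro x hx <;> rw [OpenPartialHomeomorph.trans_target] at hx
      exacts [hx.1, hx.2]
  · simp [hcz, hze]
  · have h1 := LinearMap.finrank_range_add_finrank_ker
      (L : EuclideanSpace ℝ (Fin d) →ₗ[ℝ] EuclideanSpace ℝ (Fin k))
    rw [LinearMap.range_eq_top.2 fun y => ⟨R y, hRL y⟩, finrank_top, finrank_euclideanSpace_fin,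
      finrank_euclideanSpace_fin] at h1
    omega
  · intro x hx
    rw [OpenPartialHomeomorph.trans_source] at hx
    rw [LinearMap.mem_ker, OpenPartialHomeomorph.coe_trans, Function.comp, hee]
    change Φ x = 0 ↔ L (ψ (c x)) = 0
    rw [hψ, hf, Function.comp, c.left_inv hx.1]

end Fibration

/-! ### Local triviality of `Φ/‖Φ‖` and the tube around the zero set. -/

section KnottedFibration

open Topology Filter

variable {d k : ℕ} {B : Type*} [TopologicalSpace B] [ChartedSpace (EuclideanSpace ℝ (Fin d)) B]

theorem radial_eq {B : Type*} {Φ : B → EuclideanSpace ℝ (Fin k)} {b : B} {t : ℝ} (ht : 0 < t)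
    {u : EuclideanSpace ℝ (Fin k)} (hu : ‖u‖ = 1) (h : Φ b = t • u) :
    Φ b ≠ 0 ∧ ‖Φ b‖⁻¹ • Φ b = u := by
  have hn : ‖Φ b‖ = t := by rw [h, norm_smul, hu, mul_one, Real.norm_of_nonneg ht.le]
  refine ⟨fun h0 => ?_, ?_⟩
  · rw [h0, norm_zero] at hn
    exact ht.ne hn
  · rw [hn, h, smul_smul, inv_mul_cancel₀ ht.ne', one_smul]

/-- The shear of `ℝᵏ` moving `q` in the direction of the component of `w` orthogonal to `q`. -/
noncomputable def shear (q : EuclideanSpace ℝ (Fin k))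
    (x : EuclideanSpace ℝ (Fin k) × EuclideanSpace ℝ (Fin k)) : EuclideanSpace ℝ (Fin k) :=
  x.2 + inner ℝ q x.2 • (x.1 - inner ℝ q x.1 • q)

theorem contDiff_shear (q : EuclideanSpace ℝ (Fin k)) : ContDiff ℝ ∞ (shear q) := by
  unfold shear
  exact contDiff_snd.add ((contDiff_const.inner ℝ contDiff_snd).smul
    (contDiff_fst.sub ((contDiff_const.inner ℝ contDiff_fst).smul contDiff_const)))

/-- The shear displaces orthogonally to `q`, hence preserves `⟨q, ·⟩`, and it is linear in `y`. This
is the additivity needed for gluing moves. -/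
theorem shear_shear {q : EuclideanSpace ℝ (Fin k)} (hq : ‖q‖ = 1)
    (w₁ w₂ y : EuclideanSpace ℝ (Fin k)) (r : ℝ) :
    shear q (w₂, r • shear q (w₁, y)) = r • shear q (w₁ + w₂, y) := by
  have hqq : inner ℝ q q = (1 : ℝ) := by rw [real_inner_self_eq_norm_sq, hq, one_pow]
  simp only [shear, inner_smul_right, inner_add_right, inner_sub_right, hqq, mul_one, sub_self,
    mul_zero, add_zero]
  module

/-- The parameter of the shear which moves `q` to the direction of `u`. -/
noncomputable def shearParameter (q u : EuclideanSpace ℝ (Fin k)) : EuclideanSpace ℝ (Fin k) :=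
  (inner ℝ q u : ℝ)⁻¹ • u - q

theorem inner_shearParameter {q u : EuclideanSpace ℝ (Fin k)} (hq : ‖q‖ = 1)
    (hu : (inner ℝ q u : ℝ) ≠ 0) : inner ℝ q (shearParameter q u) = (0 : ℝ) := by
  have hqq : inner ℝ q q = (1 : ℝ) := by rw [real_inner_self_eq_norm_sq, hq, one_pow]
  rw [shearParameter, inner_sub_right, inner_smul_right, hqq, inv_mul_cancel₀ hu, sub_self]

theorem shear_shearParameter {q u : EuclideanSpace ℝ (Fin k)} (hq : ‖q‖ = 1)
    (hu : (inner ℝ q u : ℝ) ≠ 0) (y : EuclideanSpace ℝ (Fin k)) :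
    shear q (shearParameter q u, y) = y + (inner ℝ q y : ℝ) • shearParameter q u := by
  simp only [shear, inner_shearParameter hq hu, zero_smul, sub_zero]

theorem contDiffAt_shearParameter {q u : EuclideanSpace ℝ (Fin k)}
    (hu : (inner ℝ q u : ℝ) ≠ 0) : ContDiffAt ℝ ∞ (shearParameter q) u := by
  unfold shearParameter
  exact (((contDiffAt_const.inner ℝ contDiffAt_id).inv hu).smul contDiffAt_id).sub contDiffAt_const

theorem contMDiffAt_radial {Φ : B → EuclideanSpace ℝ (Fin k)}
    (hΦ : ContMDiff (𝓡 d) (𝓡 k) ∞ Φ) {b : B} (hb : Φ b ≠ 0) :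
    ContMDiffAt (𝓡 d) (𝓡 k) ∞ (fun b => ‖Φ b‖⁻¹ • Φ b) b := by
  have h : ContDiffAt ℝ ∞ (fun y : EuclideanSpace ℝ (Fin k) => ‖y‖⁻¹ • y) (Φ b) :=
    ((contDiffAt_norm ℝ hb).inv (norm_ne_zero_iff.2 hb)).smul contDiffAt_id
  exact h.contMDiffAt.comp b (hΦ b)

/-- A smooth map on the open set `s` is smooth on `s` as a subset. -/
theorem smoothOnSubset_of_contMDiffAt {E₁ H₁ X E₂ H₂ Y : Type*}
    [NormedAddCommGroup E₁] [NormedSpace ℝ E₁] [TopologicalSpace H₁]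
    [TopologicalSpace X] [ChartedSpace H₁ X]
    [NormedAddCommGroup E₂] [NormedSpace ℝ E₂] [TopologicalSpace H₂]
    [TopologicalSpace Y] [ChartedSpace H₂ Y] {I : ModelWithCorners ℝ E₁ H₁}
    {J : ModelWithCorners ℝ E₂ H₂} {f : X → Y} {s U : Set X} (hU : IsOpen U) (hsU : s ⊆ U)
    (hf : ∀ x ∈ U, ContMDiffAt I J ∞ f x) : SmoothOnSubset I J f s := fun _ hx =>
  ⟨U, hU, hsU hx, f, fun y hy => (hf y hy).contMDiffWithinAt, fun _ _ => rfl⟩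

variable [IsManifold (𝓡 d) ∞ B] [CompactSpace B] [T2Space B]

/-- Moves that shear `Φ` up to a positive factor exist on all of the compact `B`. As shears are
linear isomorphisms, these moves respect the zero set, and with the right parameter they carry the
fibre over `q` to the fibre over a nearby `u`. -/
theorem isLocallyTrivialFibration_radial {Φ : B → EuclideanSpace ℝ (Fin k)}
    (hΦ : ContMDiff (𝓡 d) (𝓡 k) ∞ Φ) (ht : IsRadiallyTransverse (d := d) Φ) :
    IsLocallyTrivialFibration d (fun b => ‖Φ b‖⁻¹ • Φ b) {b | Φ b = 0}ᶜ := by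
  refine ⟨fun b hb => ?_, fun q hq' => ?_⟩
  · rw [mem_sphere_zero_iff_norm, norm_smul, norm_inv, norm_norm,
      inv_mul_cancel₀ (norm_ne_zero_iff.2 hb)]
  have hq : ‖q‖ = 1 := mem_sphere_zero_iff_norm.1 hq'
  have hqq : inner ℝ q q = (1 : ℝ) := by rw [real_inner_self_eq_norm_sq, hq, one_pow]
  obtain ⟨T, hT0, hT⟩ := exists_global_move (d := d) (B := B) (W := EuclideanSpace ℝ (Fin k))
    (Rel := fun w b b' => ∃ r : ℝ, 0 < r ∧ Φ b' = r • shear q (w, Φ b)) (K := Set.univ)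
    (fun b => ⟨1, one_pos, by simp [shear]⟩)
    (by
      rintro w₁ w₂ b₁ b₂ b₃ ⟨r, hr, h1⟩ ⟨r', hr', h2⟩
      refine ⟨r' * r, mul_pos hr' hr, ?_⟩
      rw [h2, h1, shear_shear hq, smul_smul])
    isClosed_univ
    (fun b _ => by
      obtain ⟨R₁, R₂, hR⟩ := ht.exists_rightInverse b
      obtain ⟨S, hS⟩ := exists_local_move hΦ (contDiff_shear q) (fun y => by simp [shear]) hR
      refine ⟨S, hS.mono ?_⟩
      rintro p ⟨h1, ⟨r, hr, -, h2⟩, h3⟩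
      exact ⟨h1, ⟨r, hr, h2⟩, h3⟩)
  obtain ⟨T', -, hT'⟩ := exists_global_inverse (d := d) hT0 (fun b =>
    (continuousAt_fst.eventually hT).mono fun p hp => (hp p.2).1)
  obtain ⟨O, hO, hOo, h0O⟩ := eventually_nhds_iff.1 (hT.and hT')
  have hwq : shearParameter q q = 0 := by rw [shearParameter, hqq, inv_one, one_smul, sub_self]
  set f : B → EuclideanSpace ℝ (Fin k) := fun b => ‖Φ b‖⁻¹ • Φ b with hf
  -- On this open half-space the ray of `u` meets the affine hyperplane through `q` orthogonal to
  -- `q`, at `q + shearParameter q u`.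
  let U₀ : Set (EuclideanSpace ℝ (Fin k)) := {u | 0 < (inner ℝ q u : ℝ)}
  have hU₀ : IsOpen U₀ := isOpen_lt continuous_const (by fun_prop)
  let U : Set (EuclideanSpace ℝ (Fin k)) := U₀ ∩ shearParameter q ⁻¹' O
  have hU : IsOpen U := ContinuousOn.isOpen_inter_preimage (fun u hu =>
    (contDiffAt_shearParameter (ne_of_gt hu)).continuousAt.continuousWithinAt) hU₀ hOo
  have hqU : q ∈ U := ⟨show 0 < inner ℝ q q by rw [hqq]; exact one_pos, by simpa [hwq] using h0O⟩
  have hXU : IsOpen ({b | Φ b = 0}ᶜ ∩ f ⁻¹' U) :=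
    ContinuousOn.isOpen_inter_preimage (fun b hb =>
      (contMDiffAt_radial hΦ hb).continuousAt.continuousWithinAt)
      (isClosed_eq hΦ.continuous continuous_const).isOpen_compl hU
  have hfwd : ∀ u ∈ U, ‖u‖ = 1 → ∀ y, Φ y ≠ 0 → f y = q →
      Φ (T (shearParameter q u, y)) ≠ 0 ∧ f (T (shearParameter q u, y)) = u := by
    intro u hu hun y hy hfy
    obtain ⟨r, hr, h1⟩ := ((hO _ hu.2).1 y).2 trivial
    have hu0 : 0 < (inner ℝ q u : ℝ) := hu.1
    have hyq : Φ y = ‖Φ y‖ • q := by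
      rw [← hfy, hf, smul_smul, mul_inv_cancel₀ (norm_ne_zero_iff.2 hy), one_smul]
    refine radial_eq (t := r * (‖Φ y‖ * (inner ℝ q u : ℝ)⁻¹))
      (mul_pos hr (mul_pos (norm_pos_iff.2 hy) (inv_pos.2 hu0))) hun ?_
    rw [h1, shear_shearParameter hq hu0.ne', hyq, inner_smul_right, hqq, shearParameter, norm_smul,
      hq, norm_norm]
    module
  have hbwd : ∀ x, Φ x ≠ 0 → f x ∈ U →
      Φ (T' (shearParameter q (f x), x)) ≠ 0 ∧ f (T' (shearParameter q (f x), x)) = q := by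
    intro x hx hu
    set u := f x with hudef
    set y := T' (shearParameter q u, x) with hy
    have hu0 : 0 < (inner ℝ q u : ℝ) := hu.1
    obtain ⟨r, hr, h1⟩ := ((hO _ hu.2).1 y).2 trivial
    rw [hy, ((hO _ hu.2).2 x).2.1, ← hy, shear_shearParameter hq hu0.ne'] at h1
    have hxu : Φ x = ‖Φ x‖ • u := by
      rw [hudef, hf, smul_smul, mul_inv_cancel₀ (norm_ne_zero_iff.2 hx), one_smul]
    -- Pairing with `q` eliminates the shear. The resulting sign of `⟨q, Φ y⟩` ensures that `Φ y` is
    -- a positive multiple of `q`, rather than zero or a negative one.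
    have h2 : ‖Φ x‖ * (inner ℝ q u : ℝ) = r * (inner ℝ q (Φ y) : ℝ) := by
      have h3 := congrArg (fun z => (inner ℝ q z : ℝ)) h1
      simp only [inner_smul_right, inner_add_right, inner_shearParameter hq hu0.ne', mul_zero,
        add_zero] at h3
      rw [← h3]
      conv_rhs => rw [hxu, inner_smul_right]
    have ha : 0 < (inner ℝ q (Φ y) : ℝ) := by
      have : 0 < r * (inner ℝ q (Φ y) : ℝ) := h2 ▸ mul_pos (norm_pos_iff.2 hx) hu0
      exact (mul_pos_iff_of_pos_left hr).1 this
    refine radial_eq ha hq ?_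
    have h4 : Φ y = r⁻¹ • Φ x - (inner ℝ q (Φ y) : ℝ) • shearParameter q u := by
      rw [h1, smul_smul, inv_mul_cancel₀ hr.ne', one_smul, add_sub_cancel_right]
    have h5 : r⁻¹ * ‖Φ x‖ = (inner ℝ q (Φ y) : ℝ) * (inner ℝ q u : ℝ)⁻¹ := by
      field_simp
      linarith
    rw [hxu, smul_smul, h5, shearParameter] at h4
    refine h4.trans ?_
    module
  refine ⟨U, hU, hqU, fun x => (f x, T' (shearParameter q (f x), x)), ⟨?_, ?_,
    fun z => T (shearParameter q z.1, z.2), ?_, ?_, ?_, ?_⟩, fun x _ => rfl⟩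
  · rintro x ⟨hx, hxU⟩
    have h1 : ‖f x‖ = 1 := by
      rw [hf, norm_smul, norm_inv, norm_norm, inv_mul_cancel₀ (norm_ne_zero_iff.2 hx)]
    exact ⟨⟨mem_sphere_zero_iff_norm.2 h1, hxU⟩, hbwd x hx hxU⟩
  · refine smoothOnSubset_of_contMDiffAt hXU subset_rfl fun x hx => ?_
    have h1 : ContMDiffAt (𝓡 d) (𝓡 k) ∞ f x := contMDiffAt_radial hΦ hx.1
    have h2 : ContMDiffAt (𝓡 d) (𝓡 k) ∞ (fun x => shearParameter q (f x)) x :=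
      ContMDiffAt.comp x (g := shearParameter q)
        (contDiffAt_shearParameter (ne_of_gt hx.2.1)).contMDiffAt h1
    exact h1.prodMk (ContMDiffAt.comp x (f := fun x => (shearParameter q (f x), x))
      ((hO _ hx.2.2).2 x).1 (h2.prodMk contMDiffAt_id))
  · rintro ⟨u, y⟩ ⟨⟨hu, huU⟩, hy, hfy⟩
    have h := hfwd u huU (mem_sphere_zero_iff_norm.1 hu) y hy hfy
    exact ⟨h.1, by rw [Set.mem_preimage, h.2]; exact huU⟩
  · refine smoothOnSubset_of_contMDiffAt (hU.prod isOpen_univ)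
      (Set.prod_mono Set.inter_subset_right (Set.subset_univ _)) fun z hz => ?_
    have h2 : ContMDiffAt ((𝓡 k).prod (𝓡 d)) (𝓡 k) ∞
        (fun z : EuclideanSpace ℝ (Fin k) × B => shearParameter q z.1) z :=
      ContMDiffAt.comp z (g := shearParameter q)
        (contDiffAt_shearParameter (ne_of_gt hz.1.1)).contMDiffAt contMDiffAt_fst
    exact ContMDiffAt.comp z (f := fun z : EuclideanSpace ℝ (Fin k) × B =>
      (shearParameter q z.1, z.2)) ((hO _ hz.1.2).1 z.2).1 (h2.prodMk contMDiffAt_snd)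
  · rintro x ⟨hx, hxU⟩
    exact ((hO _ hxU.2).2 x).2.1
  · rintro ⟨u, y⟩ ⟨⟨hu, huU⟩, hy, hfy⟩
    have h := hfwd u huU (mem_sphere_zero_iff_norm.1 hu) y hy hfy
    simp only [h.2, ((hO _ huU.2).2 y).2.2]

/-- Near the zero set `dΦ` is onto, so points can be moved with `Φ` changing by exactly `w`. The
tube is `(z, x) ↦ T(δx, z)`, with inverse `b ↦ (T'(Φ b, b), δ⁻¹ Φ b)`. -/
theorem exists_tube_radial {Φ : B → EuclideanSpace ℝ (Fin k)}
    (hΦ : ContMDiff (𝓡 d) (𝓡 k) ∞ Φ) (ht : IsRadiallyTransverse (d := d) Φ) :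
    ∃ W : Set B, IsOpen W ∧ {b | Φ b = 0} ⊆ W ∧
      ∃ h : B × EuclideanSpace ℝ (Fin k) → B,
        IsDiffeoOn ((𝓡 d).prod (𝓡 k)) (𝓡 d) h ({b | Φ b = 0} ×ˢ Metric.ball 0 1) W ∧
        (∀ z ∈ {b | Φ b = 0}, h (z, 0) = z) ∧
        ∀ z ∈ {b | Φ b = 0}, ∀ x ∈ Metric.ball (0 : EuclideanSpace ℝ (Fin k)) 1, x ≠ 0 →
          ‖Φ (h (z, x))‖⁻¹ • Φ (h (z, x)) = ‖x‖⁻¹ • x := by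
  have hclosed : IsClosed {b | Φ b = 0} := isClosed_eq hΦ.continuous continuous_const
  let V₀ : Set B := {b | ∃ S : EuclideanSpace ℝ (Fin k) × B → B,
    ∀ᶠ p in 𝓝 ((0 : EuclideanSpace ℝ (Fin k)), b),
      ContMDiffAt (𝓘(ℝ, EuclideanSpace ℝ (Fin k)).prod (𝓡 d)) (𝓡 d) ∞ S p ∧
        Φ (S p) = Φ p.2 + p.1 ∧ S (0, p.2) = p.2}
  have hV₀ : IsOpen V₀ := by
    have : V₀ = ⋃ S : EuclideanSpace ℝ (Fin k) × B → B,
        {b | ∀ᶠ p in 𝓝 ((0 : EuclideanSpace ℝ (Fin k)), b),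
          ContMDiffAt (𝓘(ℝ, EuclideanSpace ℝ (Fin k)).prod (𝓡 d)) (𝓡 d) ∞ S p ∧
            Φ (S p) = Φ p.2 + p.1 ∧ S (0, p.2) = p.2} := by
      ext b
      simp [V₀]
    rw [this]
    exact isOpen_iUnion fun S => isOpen_setOfPred_eventually_nhds.preimage
      (by fun_prop : Continuous fun x : B => ((0 : EuclideanSpace ℝ (Fin k)), x))
  have hsub : {b | Φ b = 0} ⊆ V₀ := by
    intro b hb
    have hb' : Φ b = 0 := hb
    obtain ⟨R₁, R₂, hR⟩ := ht.exists_rightInverse b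
    obtain ⟨S, hS⟩ := exists_local_move (W := EuclideanSpace ℝ (Fin k)) hΦ
      (G := fun x => x.2 + x.1) (contDiff_snd.add contDiff_fst)
      -- Since `Φ b = 0`, the radial part may be replaced by `0`, which forces the factor `r` to be
      -- `1`.
      (fun y => by simp) (R₁ := R₁) (R₂ := 0) (fun y => by simpa [hb'] using hR y)
    refine ⟨S, hS.mono ?_⟩
    rintro p ⟨h1, ⟨r, -, hr, h2⟩, h3⟩
    exact ⟨h1, by rw [h2, hr rfl, one_smul], h3⟩
  obtain ⟨V, hV, hNV, hVV₀⟩ := normal_exists_closure_subset hclosed hV₀ hsub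
  obtain ⟨T, hT0, hT⟩ := exists_global_move (d := d) (B := B) (W := EuclideanSpace ℝ (Fin k))
    (Rel := fun w b b' => Φ b' = Φ b + w) (K := closure V) (fun b => (add_zero _).symm)
    (fun w₁ w₂ b₁ b₂ b₃ h1 h2 => by rw [h2, h1, add_assoc]) isClosed_closure
    (fun b hb => hVV₀ hb)
  obtain ⟨T', hT'0, hT'⟩ := exists_global_inverse (d := d) hT0 (fun b =>
    (continuousAt_fst.eventually hT).mono fun p hp => (hp p.2).1)
  obtain ⟨δ, hδ, hδT⟩ := Metric.eventually_nhds_iff.1 (hT.and hT')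
  have hδT' : ∀ w : EuclideanSpace ℝ (Fin k), ‖w‖ < δ → _ := fun w hw =>
    hδT (y := w) (by rwa [dist_zero_right])
  have hscale : ∀ x ∈ Metric.ball (0 : EuclideanSpace ℝ (Fin k)) 1, ‖δ • x‖ < δ := by
    intro x hx
    rw [norm_smul, Real.norm_of_nonneg hδ.le]
    exact mul_lt_of_lt_one_right hδ (mem_ball_zero_iff.1 hx)
  have hval : ∀ z, Φ z = 0 → ∀ x ∈ Metric.ball (0 : EuclideanSpace ℝ (Fin k)) 1,
      Φ (T (δ • x, z)) = δ • x := by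
    intro z hz x hx
    rw [((hδT' _ (hscale x hx)).1 z).2 (subset_closure (hNV hz)), hz, zero_add]
  let W₀ : Set B := {b | ‖Φ b‖ < δ}
  have hW₀ : IsOpen W₀ := isOpen_lt hΦ.continuous.norm continuous_const
  have hsm : ∀ b ∈ W₀, ContMDiffAt (𝓡 d) (𝓡 d) ∞ (fun b => T' (Φ b, b)) b := fun b hb =>
    ContMDiffAt.comp b (f := fun b => (Φ b, b)) ((hδT' _ hb).2 b).1 ((hΦ b).prodMk contMDiffAt_id)
  -- `T` is known to translate `Φ` only from points of `closure V`. Requiring the point moved back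
  -- to lie in `V` therefore guarantees that it is a zero of `Φ`.
  have hW : IsOpen (W₀ ∩ (fun b => T' (Φ b, b)) ⁻¹' V) :=
    ContinuousOn.isOpen_inter_preimage
      (fun b hb => (hsm b hb).continuousAt.continuousWithinAt) hW₀ hV
  refine ⟨W₀ ∩ (fun b => T' (Φ b, b)) ⁻¹' V, hW, ?_, fun y => T (δ • y.2, y.1),
    ⟨?_, ?_, fun b => (T' (Φ b, b), δ⁻¹ • Φ b), ?_, ?_, ?_, ?_⟩, ?_, ?_⟩
  · intro z hz
    have hz' : Φ z = 0 := hz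
    refine ⟨by simp [W₀, hz', hδ], ?_⟩
    rw [Set.mem_preimage, hz', hT'0]
    exact hNV hz
  · rintro ⟨z, x⟩ ⟨hz, hx⟩
    have h1 := hval z hz x hx
    refine ⟨?_, ?_⟩
    · change ‖Φ (T (δ • x, z))‖ < δ
      rw [h1]
      exact hscale x hx
    · change T' (Φ (T (δ • x, z)), T (δ • x, z)) ∈ V
      rw [h1, ((hδT' _ (hscale x hx)).2 z).2.2]
      exact hNV hz
  · refine smoothOnSubset_of_contMDiffAt (isOpen_univ.prod Metric.isOpen_ball)
      (Set.prod_mono (Set.subset_univ _) subset_rfl) fun y hy => ?_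
    have h2 : ContMDiffAt ((𝓡 d).prod (𝓡 k)) (𝓡 k) ∞
        (fun y : B × EuclideanSpace ℝ (Fin k) => δ • y.2) y :=
      ContMDiffAt.comp y (contDiff_const_smul δ).contMDiff.contMDiffAt contMDiffAt_snd
    exact ContMDiffAt.comp y (f := fun y : B × EuclideanSpace ℝ (Fin k) => (δ • y.2, y.1))
      ((hδT' _ (hscale _ hy.2)).1 y.1).1 (h2.prodMk contMDiffAt_fst)
  · rintro b ⟨hb, hbV⟩
    have h1 := ((hδT' _ hb).1 (T' (Φ b, b))).2 (subset_closure hbV)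
    rw [((hδT' _ hb).2 b).2.1] at h1
    refine ⟨by simpa using h1.symm, ?_⟩
    rw [mem_ball_zero_iff, norm_smul, norm_inv, Real.norm_of_nonneg hδ.le, inv_mul_lt_one₀ hδ]
    exact hb
  · refine smoothOnSubset_of_contMDiffAt hW₀ Set.inter_subset_left fun b hb => ?_
    exact (hsm b hb).prodMk
      (ContMDiffAt.comp b (contDiff_const_smul δ⁻¹).contMDiff.contMDiffAt (hΦ b))
  · rintro ⟨z, x⟩ ⟨hz, hx⟩
    simp only [hval z hz x hx, ((hδT' _ (hscale x hx)).2 z).2.2, smul_smul,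
      inv_mul_cancel₀ hδ.ne', one_smul]
  · rintro b ⟨hb, hbV⟩
    simp only [smul_smul, mul_inv_cancel₀ hδ.ne', one_smul, ((hδT' _ hb).2 b).2.1]
  · intro z _
    simp only [smul_zero, hT0]
  · intro z hz x hx _
    simp only [hval z hz x hx, norm_smul, Real.norm_of_nonneg hδ.le, smul_smul]
    congr 1
    field_simp

end KnottedFibration

/-! ### Assembly of the knotted fibration. -/

/-- A map whose components in every unit direction have nonzero differential along their zero sets
is radially transverse. -/
theorem isRadiallyTransverse_of_mfderiv_ne_zero {d k : ℕ} {B : Type*} [TopologicalSpace B]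
    [ChartedSpace (EuclideanSpace ℝ (Fin d)) B] [IsManifold (𝓡 d) ∞ B]
    {Φ : B → EuclideanSpace ℝ (Fin k)} (hΦ : ContMDiff (𝓡 d) (𝓡 k) ∞ Φ)
    (h : ∀ l : EuclideanSpace ℝ (Fin k), ‖l‖ = 1 → ∀ b, inner ℝ l (Φ b) = 0 →
      mfderiv (𝓡 d) 𝓘(ℝ, ℝ) (fun x => (inner ℝ l (Φ x) : ℝ)) b ≠ 0) :
    IsRadiallyTransverse (d := d) Φ := by
  intro b l hl hb
  by_contra! hv
  set c := chartAt (EuclideanSpace ℝ (Fin d)) b with hc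
  have hcb : b ∈ c.source := mem_chart_source _ _
  set l' := ‖l‖⁻¹ • l with hl'
  have hn : ‖l'‖ = 1 := by
    rw [hl', norm_smul, norm_inv, norm_norm, inv_mul_cancel₀ (norm_ne_zero_iff.2 hl)]
  refine h l' hn b (by rw [hl', real_inner_smul_left, hb, mul_zero]) ?_
  have hfd : DifferentiableAt ℝ (Φ ∘ c.symm) (c b) :=
    (((hΦ _).comp (c b) (contMDiffAt_symm_of_mem_maximalAtlas
      (IsManifold.chart_mem_maximalAtlas b) (c.map_source hcb))).contDiffAt).differentiableAt
      (by simp)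
  have h1 : HasFDerivAt (fun x => (inner ℝ l' ((Φ ∘ c.symm) x) : ℝ))
      (0 : EuclideanSpace ℝ (Fin d) →L[ℝ] ℝ) (c b) := by
    refine ((innerSL ℝ l').hasFDerivAt.comp (c b) hfd.hasFDerivAt).congr_fderiv ?_
    ext v
    change inner ℝ l' _ = (0 : ℝ)
    rw [hl', real_inner_smul_left]
    exact mul_eq_zero_of_right _ (hv v)
  have hcd := (contMDiffAt_of_mem_maximalAtlas (IsManifold.chart_mem_maximalAtlas (I := 𝓡 d)
    (n := ∞) b) hcb).mdifferentiableAt (by simp)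
  have h2 := h1.hasMFDerivAt.comp b hcd.hasMFDerivAt
  refine (h2.congr_of_eventuallyEq ?_).mfderiv.trans (ContinuousLinearMap.zero_comp _)
  filter_upwards [c.open_source.mem_nhds hcb] with x hx
  simp only [Function.comp, c.left_inv hx]

theorem isKnottedFibration_radial {d k : ℕ} {B : Type*} [TopologicalSpace B] [T2Space B]
    [CompactSpace B] [ConnectedSpace B] [ChartedSpace (EuclideanSpace ℝ (Fin d)) B]
    [IsManifold (𝓡 d) ∞ B] (hB : IsOrientable d B) {Φ : B → EuclideanSpace ℝ (Fin k)}
    (hΦ : ContMDiff (𝓡 d) (𝓡 k) ∞ Φ) (ht : IsRadiallyTransverse (d := d) Φ) :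
    IsKnottedFibration d B (fun b => ‖Φ b‖⁻¹ • Φ b) {b | Φ b = 0} where
  connected := inferInstance
  orientable := hB
  compact := inferInstance
  -- The submanifold condition holds vacuously if the zero set is empty.
  knot := Or.inr (isClosedSubmanifold_zero hΦ ht)
  fibration := isLocallyTrivialFibration_radial hΦ ht
  tube := fun _ => exists_tube_radial hΦ ht

end ContactSphere

theorem mainTheorem7 (n p : ℕ)
    (B : Type*) [TopologicalSpace B] [T2Space B] [CompactSpace B] [ConnectedSpace B]
    [ChartedSpace (EuclideanSpace ℝ (Fin (2 * n))) B] [IsManifold (𝓡 (2 * n)) ∞ B]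
    (hB : ContactSphere.IsOrientable (2 * n) B)
    (M : Type*) [TopologicalSpace M] [T2Space M]
    [ChartedSpace (EuclideanSpace ℝ (Fin (2 * n + 1))) M] [IsManifold (𝓡 (2 * n + 1)) ∞ M]
    [MulAction Circle M] (π : M → B)
    (hπ : ContactSphere.IsPrincipalCircleBundle (d := 2 * n + 1) (e := 2 * n) π)
    (α : ContactSphere.OneForm (2 * n + 1) M) (hα : ContactSphere.IsConnectionForm α)
    (Ω : Fin (p + 1) → ContactSphere.OneForm (2 * n + 1) M)
    (hΩ : ContactSphere.IsContactSphere n Ω)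
    (hinv : ∀ θ ∈ ContactSphere.normalizedCombinations Ω, θ.IsInvariant)
    (η : Fin (p + 1) → ContactSphere.OneForm (2 * n) B) (hη : ∀ i, (η i).IsSmooth)
    (φ : Fin (p + 1) → B → ℝ) (hφ : ∀ i, ContMDiff (𝓡 (2 * n)) 𝓘(ℝ, ℝ) ∞ (φ i))
    (hdec : ∀ i m, Ω i m = (η i).pullback π m + φ i (π m) • α m) :
    ContactSphere.IsKnottedFibration (2 * n) B
      (fun b => WithLp.toLp 2 (fun i => φ i b / √(∑ j, φ j b ^ 2)))
      (⋂ i, φ i ⁻¹' {0}) := by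
  let Φ : B → EuclideanSpace ℝ (Fin (p + 1)) := fun b => WithLp.toLp 2 (fun i => φ i b)
  have hΦ : ContMDiff (𝓡 (2 * n)) (𝓡 (p + 1)) ∞ Φ := by
    have h : ContMDiff (𝓡 (2 * n)) 𝓘(ℝ, Fin (p + 1) → ℝ) ∞ fun b i => φ i b :=
      contMDiff_pi_space.2 hφ
    exact (PiLp.contDiff_toLp (𝕜 := ℝ) (p := 2)).contMDiff.comp h
  have hinner : ∀ l : EuclideanSpace ℝ (Fin (p + 1)), ∀ b,
      (inner ℝ l (Φ b) : ℝ) = ∑ i, l i * φ i b := fun l b => by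
    simp [Φ, PiLp.inner_apply, mul_comm]
  have hnorm : ∀ b, ‖Φ b‖ = √(∑ j, φ j b ^ 2) := fun b => by
    simp [Φ, EuclideanSpace.norm_eq]
  have ht : ContactSphere.IsRadiallyTransverse (d := 2 * n) Φ := by
    refine ContactSphere.isRadiallyTransverse_of_mfderiv_ne_zero hΦ fun l hl b hb => ?_
    rw [hinner] at hb
    rw [show (fun x => (inner ℝ l (Φ x) : ℝ)) = fun x => ∑ i, l i * φ i x from funext (hinner l)]
    refine hΩ.mfderiv_ne_zero hπ hα hη hφ hdec l ?_ b hb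
    rw [← EuclideanSpace.real_norm_sq_eq, hl, one_pow]
  -- The equality holds on the zero set as well, where both sides are `0` by the convention for
  -- division by zero.
  have hf : (fun b => WithLp.toLp 2 (fun i => φ i b / √(∑ j, φ j b ^ 2))) =
      fun b => ‖Φ b‖⁻¹ • Φ b := by
    funext b
    ext i
    simp [hnorm, Φ, div_eq_inv_mul]
  have hN : (⋂ i, φ i ⁻¹' {0}) = {b | Φ b = 0} := by
    ext b
    simp [Φ, funext_iff]
  rw [hf, hN]
  exact ContactSphere.isKnottedFibration_radial hB hΦ ht
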